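/- Let $n\in\mathbb N$, $T>0$, $0\le h\le T$, and let $A_0,A_1,W:\mathbb R\to\mathbb R^{n\times n}$ be continuous and $T$-periodic, with $W(t)=W^{T}(t)$ for all $t$. Let $\mathcal H=\mathbb C^n\times L^2([-h,0],\mathbb C^n)$ with the inner product $\langle\varphi,\psi\rangle=\varphi_0^\star\psi_0+\int_{-h}^0\Phi^\star(\theta)\Psi(\theta)\,d\theta$ for $\varphi=(\varphi_0,\Phi)$, $\psi=(\psi_0,\Psi)$. For $\varphi\in\mathcal H$ let $x(\cdot,t_0,\varphi)$ be the solution of the delay system $$\dot x(t)=A_0(t)x(t)+A_1(t)x(t-h)\ \text{ for a.e. } t\ge t_0,\qquad x(t_0)=\varphi_0,\quad x(t_0+\xi)=\Phi(\xi)\ \text{ for a.e. } \xi\in[-h,0],$$ that is locally absolutely continuous on $[t_0,\infty)$. Let $S(t,t_0)\varphi=\bigl(x(t,t_0,\varphi),\,\theta\mapsto x(t+\theta,t_0,\varphi)\bigr)\in\mathcal H$ for $t\ge t_0$ be the associated evolution family, and $\mathcal U=S(T,0)$ the monodromy operator. Let $K(t,s)$ be the fundamental matrix: $K(t,s)=0$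 for $t<s$, $K(s,s)=I$, $K(\cdot,s)$ is continuous on $[s,\infty)$, and $\partial_tK(t,s)=A_0(t)K(t,s)+A_1(t)K(t-h,s)$ for $t>s$, $t\ne s+h$. Let $\mathcal W(t)\varphi=(W(t)\varphi_0,0)$ for $\varphi\in\mathcal H$. Suppose that $U_0\in C([0,h]^2,\mathbb R^{n\times n})$ satisfies, for all $\theta,s\in[0,h]$, $$U_0(\theta,s)=[\mathcal L U_0](\theta,s)+\int_0^T K^T(\xi,\theta)W(\xi)K(\xi,s)\,d\xi,$$ where $$\begin{aligned}{}[\mathcal L U_0](\theta,s)&=K^T(T,\theta)U_0(0,0)K(T,s)+K^T(T,\theta)\int_{-h}^0U_0(0,h+\xi)A_1(h+\xi)K(T+\xi,s)\,d\xi\\&\quad+\int_{-h}^0K^T(T+\xi,\theta)A_1^T(h+\xi)U_0(\xi+h,0)\,d\xi\,K(T,s)\\&\quad+\int_{-h}^0\!\int_{-h}^0K^T(T+\xi_1,\theta)A_1^T(h+\xi_1)U_0(h+\xi_1,h+\xi_2)A_1(h+\xi_2)K(T+\xi_2,s)\,d\xi_2\,d\xi_1.\end{aligned}$$ Then the formula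 $$\mathcal P(0)\varphi=\begin{pmatrix}U_0(0,0)\varphi_0+\int_{-h}^0U_0(0,h+\theta)A_1(h+\theta)\Phi(\theta)\,d\theta\\[2pt] A_1^T(h+\cdot)\Bigl[U_0(h+\cdot,0)\varphi_0+\int_{-h}^0U_0(h+\cdot,h+s)A_1(h+s)\Phi(s)\,ds\Bigr]\end{pmatrix}$$ defines a bounded linear operator $\mathcal P(0)$ on $\mathcal H$, and $\mathcal P(0)$ solves the discrete operator Lyapunov equation $$\langle\varphi,\mathcal P(0)\varphi\rangle-\langle\mathcal U\varphi,\mathcal P(0)\,\mathcal U\varphi\rangle=\int_0^T\langle S(\xi,0)\varphi,\mathcal W(\xi)S(\xi,0)\varphi\rangle\,d\xi\qquad\text{for all }\varphi\in\mathcal H,$$ the integrand on the right being integrable on $[0,T]$. -/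

import Mathlib

open MeasureTheory Set

noncomputable section

namespace DelayLyap

/-- The complex vector space `ℂⁿ` with its Euclidean inner product. -/
abbrev Vec (n : ℕ) : Type := EuclideanSpace ℂ (Fin n)

/-- Real `n × n` matrices. -/
abbrev Mat (n : ℕ) : Type := Matrix (Fin n) (Fin n) ℝ

/-- Lebesgue measure on the interval `[-h, 0]`. -/
abbrev histMeasure (h : ℝ) : Measure ℝ := volume.restrict (Icc (-h) 0)

/-- The space `L²([-h, 0], ℂⁿ)`. -/
abbrev Hist (n : ℕ) (h : ℝ) : Type := Lp (Vec n) 2 (histMeasure h)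

/-- The state space `ℂⁿ × L²([-h, 0], ℂⁿ)` with the inner product
`⟪φ, ψ⟫ = φ₀* ψ₀ + ∫_{-h}^0 Φ(θ)* Ψ(θ) dθ`. -/
abbrev State (n : ℕ) (h : ℝ) : Type := WithLp 2 (Vec n × Hist n h)

/-- The action of a real matrix on `ℂⁿ`. -/
def act {n : ℕ} (A : Mat n) : Vec n →L[ℂ] Vec n :=
  Matrix.toEuclideanCLM (𝕜 := ℂ) (A.map (fun r : ℝ => (r : ℂ)))

/-- The entrywise integral of a matrix function. -/
def matIntegral {n : ℕ} (a b : ℝ) (F : ℝ → Mat n) : Mat n :=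
  Matrix.of fun i j => ∫ t in a..b, F t i j

/-- `x` is a solution of `x'(t) = A₀(t) x(t) + A₁(t) x(t - h)` for `t ≥ t₀` with the initial data
`x(t₀) = φ₀` and `x(t₀ + ξ) = Φ(ξ)` for almost all `ξ ∈ [-h, 0]`: it is locally absolutely
continuous on `[t₀, ∞)` and the equation holds for almost all `t ≥ t₀`. -/
structure IsSolution {n : ℕ} (A₀ A₁ : ℝ → Mat n) (h t₀ : ℝ) (φ : State n h)
    (x : ℝ → Vec n) : Prop where
  initial : x t₀ = φ.fst
  history : ∀ᵐ ξ ∂(histMeasure h), x (t₀ + ξ) = φ.snd ξ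
  absCont : ∀ b, t₀ ≤ b → AbsolutelyContinuousOnInterval x t₀ b
  equation : ∀ᵐ t ∂(volume.restrict (Ici t₀)),
    HasDerivAt x (act (A₀ t) (x t) + act (A₁ t) (x (t - h))) t

/-- `z` is the state `(x(t), θ ↦ x(t + θ))` of the function `x` at the time `t`. -/
def IsStateAt {n : ℕ} {h : ℝ} (x : ℝ → Vec n) (t : ℝ) (z : State n h) : Prop :=
  z.fst = x t ∧ ∀ᵐ θ ∂(histMeasure h), z.snd θ = x (t + θ)

/-- The evolution family `S(t, t₀) φ = (x(t), x_t)`, where `x` is the solution that starts at the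
time `t₀` from `φ`. -/
def evolution {n : ℕ} (A₀ A₁ : ℝ → Mat n) (h t t₀ : ℝ) (φ : State n h) : State n h :=
  Classical.epsilon fun z => ∃ x, IsSolution A₀ A₁ h t₀ φ x ∧ IsStateAt x t z

/-- The monodromy operator `S(T, 0)`. -/
def monodromy {n : ℕ} (A₀ A₁ : ℝ → Mat n) (h T : ℝ) (φ : State n h) : State n h :=
  evolution A₀ A₁ h T 0 φ

/-- The defining properties of the fundamental matrix `K(t, s)`. Since `K(· - h, s)` jumps at
`t = s + h`, the function `K(·, s)` need not be differentiable there; it is continuous on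
`[s, ∞)` and satisfies the differential equation at all other `t > s`. -/
structure IsFundamentalMatrix {n : ℕ} (A₀ A₁ : ℝ → Mat n) (h : ℝ) (K : ℝ → ℝ → Mat n) :
    Prop where
  before : ∀ s t, t < s → K t s = 0
  diag : ∀ s, K s s = 1
  cont : ∀ s, ContinuousOn (fun t => K t s) (Ici s)
  equation : ∀ s t, s < t → t ≠ s + h → ∀ i j,
    HasDerivAt (fun r => K r s i j) ((A₀ t * K t s + A₁ t * K (t - h) s) i j) t

/-- The fundamental matrix `K(t, s)`. -/
def fundMatrix {n : ℕ} (A₀ A₁ : ℝ → Mat n) (h : ℝ) : ℝ → ℝ → Mat n :=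
  Classical.epsilon (IsFundamentalMatrix A₀ A₁ h)

/-- The operator `𝓛`, for a given fundamental matrix `K`. -/
def opL {n : ℕ} (A₁ : ℝ → Mat n) (h T : ℝ) (K : ℝ → ℝ → Mat n) (U : ℝ → ℝ → Mat n)
    (θ s : ℝ) : Mat n :=
  (K T θ).transpose * U 0 0 * K T s
  + (K T θ).transpose
      * matIntegral (-h) 0 (fun ξ => U 0 (h + ξ) * A₁ (h + ξ) * K (T + ξ) s)
  + matIntegral (-h) 0
        (fun ξ => (K (T + ξ) θ).transpose * (A₁ (h + ξ)).transpose * U (ξ + h) 0) * K T s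
  + matIntegral (-h) 0 (fun ξ₁ => matIntegral (-h) 0 (fun ξ₂ =>
      (K (T + ξ₁) θ).transpose * (A₁ (h + ξ₁)).transpose * U (h + ξ₁) (h + ξ₂)
        * A₁ (h + ξ₂) * K (T + ξ₂) s))

/-- The inhomogeneity `I_W(θ, s) = ∫_0^T K(ξ, θ)ᵀ W(ξ) K(ξ, s) dξ`. -/
def inhom {n : ℕ} (W : ℝ → Mat n) (T : ℝ) (K : ℝ → ℝ → Mat n) (θ s : ℝ) : Mat n :=
  matIntegral 0 T fun ξ => (K ξ θ).transpose * W ξ * K ξ s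

/-- The bounded operator `𝓦(t) φ = (W(t) φ₀, 0)`. -/
def weightOp {n : ℕ} (h : ℝ) (W : ℝ → Mat n) (t : ℝ) : State n h →L[ℂ] State n h :=
  ((WithLp.prodContinuousLinearEquiv 2 ℂ (Vec n) (Hist n h)).symm :
      (Vec n × Hist n h) →L[ℂ] State n h) ∘L
    ContinuousLinearMap.inl ℂ (Vec n) (Hist n h) ∘L act (W t) ∘L
    WithLp.fstL 2 ℂ (Vec n) (Hist n h)

theorem weightOp_apply {n : ℕ} (h : ℝ) (W : ℝ → Mat n) (t : ℝ) (φ : State n h) :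
    weightOp h W t φ = WithLp.toLp 2 (act (W t) φ.fst, 0) := rfl

/-- The bounded operator `P` is given by the explicit formula in terms of `U₀` and `A₁`. -/
structure IsLyapunovOperator {n : ℕ} {h : ℝ} (A₁ : ℝ → Mat n) (U₀ : ℝ → ℝ → Mat n)
    (P : State n h →L[ℂ] State n h) : Prop where
  fst_eq : ∀ φ : State n h, (P φ).fst =
    act (U₀ 0 0) φ.fst + ∫ θ in (-h)..0, act (U₀ 0 (h + θ) * A₁ (h + θ)) (φ.snd θ)
  snd_eq : ∀ φ : State n h, ∀ᵐ θ ∂(histMeasure h), (P φ).snd θ =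
    act (A₁ (h + θ)).transpose (act (U₀ (h + θ) 0) φ.fst
      + ∫ s in (-h)..0, act (U₀ (h + θ) (h + s) * A₁ (h + s)) (φ.snd s))

end DelayLyap

end

open DelayLyap

/-! Let `μ = atomMeasure h`, the unit mass at `-h` plus Lebesgue measure on `(-h, 0]`. A state `φ`
is encoded by one density `f = inputFun A₁ φ` for `μ`: `f(-h) = φ₀` and `f(ξ) = A₁(h+ξ) Φ(ξ)`
elsewhere. In these terms every formula of the theorem is a single integral.

Variation of constants becomes `x(t) = ∫ K(t, h+ξ) f(ξ) dμ(ξ)` for `t ≥ 0`, and moving `A₁ᵀ` across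
the inner product gives `⟨φ, Pφ⟩ = ∬ f(ξ)* U₀(h+ξ, h+η) f(η) dμ dμ` (`inner_lyapunovOperator`). The
kernel `N = monodromyKernel` carries the density of `φ` to that of the monodromy state
(`integral_monodromyKernel`), and the four terms of `𝓛` are the four pieces of `∬ N(p, ξ)ᵀ U₀(h+p,
h+q) N(q, η) dμ dμ` (`act_opL`).

Substitute the equation for `U₀` into the quadratic form and apply Fubini twice, in the form of
`integral_inner_sandwich`. The `𝓛` part becomes the same quadratic form at the monodromy state, the
inhomogeneity becomes `∫ x* W x` over `[0, T]`, and the latter is the right-hand side of the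
Lyapunov equation (`integral_rowFun_eq`).

Since `fundMatrix` and `evolution` are choices, existence and uniqueness must be proved for both: a
weighted contraction yields `K`, variation of constants yields the solution, and a delay Gronwall
inequality gives both uniqueness statements. -/

noncomputable section

namespace DelayLyap

/-! ### The fundamental solution as a fixed point of a Volterra operator. -/

section Volterra

/-- Integrating an exponential weight gains the factor `1 / l`, which is what makes the Volterra
operator contract for large `l`. -/
theorem norm_integral_le_of_norm_le_exp {E : Type*} [NormedAddCommGroup E] [NormedSpace ℝ E]
    {f : ℝ → E} {C l u : ℝ} (hl : 0 < l) (hu : 0 ≤ u) (hC : 0 ≤ C)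
    (hf : ∀ σ ∈ Ioc 0 u, ‖f σ‖ ≤ C * Real.exp (l * σ)) :
    ‖∫ σ in (0 : ℝ)..u, f σ‖ ≤ C * Real.exp (l * u) / l := by
  have h1 : ‖∫ σ in (0 : ℝ)..u, f σ‖ ≤ ∫ σ in (0 : ℝ)..u, C * Real.exp (l * σ) := by
    refine intervalIntegral.norm_integral_le_of_norm_le hu (.of_forall hf) ?_
    exact Continuous.intervalIntegrable (by fun_prop) _ _
  refine h1.trans ?_
  have h2 : ∫ σ in (0 : ℝ)..u, Real.exp (l * σ) = (Real.exp (l * u) - 1) / l := by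
    rw [intervalIntegral.integral_comp_mul_left (fun x => Real.exp x) hl.ne']
    simp [div_eq_inv_mul]
  rw [intervalIntegral.integral_const_mul, h2, mul_div_assoc]
  have : (Real.exp (l * u) - 1) / l ≤ Real.exp (l * u) / l := by gcongr; linarith
  gcongr

variable {R : Type*} [NormedRing R] [NormedAlgebra ℝ R]

/-- The linear part of the weighted Volterra operator of a delay equation. -/
def volterraLin (a b : ℝ → R) (h l : ℝ) (g : ℝ × ℝ → R) (p : ℝ × ℝ) : R :=
  Real.exp (-(l * max p.1 0)) •
    ((∫ σ in (0 : ℝ)..(max p.1 0), Real.exp (l * σ) • (a (p.2 + σ) * g (σ, p.2)))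
      + ∫ σ in (0 : ℝ)..(max (p.1 - h) 0), Real.exp (l * σ) • (b (p.2 + h + σ) * g (σ, p.2)))

theorem continuous_volterraLin {a b : ℝ → R} (ha : Continuous a) (hb : Continuous b)
    (h l : ℝ) {g : ℝ × ℝ → R} (hg : Continuous g) : Continuous (volterraLin a b h l g) := by
  have key : ∀ (c : ℝ → R) (r : ℝ) (u : ℝ × ℝ → ℝ), Continuous c → Continuous u →
      Continuous fun p : ℝ × ℝ =>
        ∫ σ in (0 : ℝ)..(u p), Real.exp (l * σ) • (c (p.2 + r + σ) * g (σ, p.2)) := by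
    intro c r u hc hu
    refine intervalIntegral.continuous_parametric_intervalIntegral_of_continuous ?_ hu
    simp only [Function.uncurry_def]
    fun_prop
  have h1 := key a 0 (fun p => max p.1 0) ha (by fun_prop)
  have h2 := key b h (fun p => max (p.1 - h) 0) hb (by fun_prop)
  simp only [add_zero] at h1
  unfold volterraLin
  exact Continuous.smul (by fun_prop) (h1.add h2)

/-- The prefactor `exp (-(l * max p.1 0))` cancels the growth of both integrals. The delayed one
runs over a shorter interval because `h ≥ 0`, so each contributes `M * C / l`, uniformly in `p`. -/
theorem norm_volterraLin_le {a b : ℝ → R} {M h l : ℝ} (hh : 0 ≤ h) (hl : 0 < l) (hM : 0 ≤ M)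
    (ha : ∀ t, ‖a t‖ ≤ M) (hb : ∀ t, ‖b t‖ ≤ M) {g : ℝ × ℝ → R} {C : ℝ} (hC : 0 ≤ C)
    (hg : ∀ p, ‖g p‖ ≤ C) (p : ℝ × ℝ) :
    ‖volterraLin a b h l g p‖ ≤ 2 * (M * C) / l := by
  have key : ∀ (c : ℝ → R) (r u : ℝ), (∀ t, ‖c t‖ ≤ M) → 0 ≤ u → u ≤ max p.1 0 →
      ‖∫ σ in (0 : ℝ)..u, Real.exp (l * σ) • (c (p.2 + r + σ) * g (σ, p.2))‖
        ≤ M * C * Real.exp (l * max p.1 0) / l := by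
    intro c r u hc hu hu'
    refine (norm_integral_le_of_norm_le_exp hl hu (mul_nonneg hM hC) ?_).trans ?_
    · intro σ _
      rw [norm_smul, Real.norm_of_nonneg (Real.exp_nonneg _), mul_comm]
      gcongr
      exact (norm_mul_le _ _).trans (mul_le_mul (hc _) (hg _) (norm_nonneg _) hM)
    · gcongr
  have h1 := key a 0 _ ha (le_max_right p.1 0) le_rfl
  have h2 := key b h _ hb (le_max_right (p.1 - h) 0) (max_le_max_right 0 (by linarith))
  simp only [add_zero] at h1
  unfold volterraLin
  rw [norm_smul, Real.norm_of_nonneg (Real.exp_nonneg _)]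
  calc _ ≤ Real.exp (-(l * max p.1 0)) *
        (M * C * Real.exp (l * max p.1 0) / l + M * C * Real.exp (l * max p.1 0) / l) := by
        gcongr
        exact (norm_add_le _ _).trans (add_le_add h1 h2)
    _ = (Real.exp (-(l * max p.1 0)) * Real.exp (l * max p.1 0)) * (2 * (M * C) / l) := by ring
    _ = _ := by rw [← Real.exp_add]; simp

theorem volterraLin_sub {a b : ℝ → R} (ha : Continuous a) (hb : Continuous b)
    (h l : ℝ) {f g : ℝ × ℝ → R} (hf : Continuous f) (hg : Continuous g) (p : ℝ × ℝ) :
    volterraLin a b h l (fun q => f q - g q) p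
      = volterraLin a b h l f p - volterraLin a b h l g p := by
  have key : ∀ (c : ℝ → R) (r u : ℝ), Continuous c →
      ∫ σ in (0 : ℝ)..u, Real.exp (l * σ) • (c (p.2 + r + σ) * (f (σ, p.2) - g (σ, p.2)))
      = (∫ σ in (0 : ℝ)..u, Real.exp (l * σ) • (c (p.2 + r + σ) * f (σ, p.2)))
        - ∫ σ in (0 : ℝ)..u, Real.exp (l * σ) • (c (p.2 + r + σ) * g (σ, p.2)) := by
    intro c r u hc
    rw [← intervalIntegral.integral_sub (Continuous.intervalIntegrable (by fun_prop) _ _)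
      (Continuous.intervalIntegrable (by fun_prop) _ _)]
    simp only [mul_sub, smul_sub]
  have h1 := key a 0 (max p.1 0) ha
  have h2 := key b h (max (p.1 - h) 0) hb
  simp only [add_zero] at h1
  simp only [volterraLin, h1, h2, ← smul_sub]
  congr 1
  abel

open scoped BoundedContinuousFunction in
/-- The fundamental solution of a linear delay equation with bounded continuous coefficients, in
the variables (elapsed time, initial time). -/
theorem exists_fundamental_solution [CompleteSpace R] {a b : ℝ → R} {M h : ℝ}
    (hh : 0 ≤ h) (ha : Continuous a) (hb : Continuous b)
    (haM : ∀ t, ‖a t‖ ≤ M) (hbM : ∀ t, ‖b t‖ ≤ M) :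
    ∃ Z : ℝ × ℝ → R, Continuous Z ∧ ∀ τ s, 0 ≤ τ → Z (τ, s) = 1
      + (∫ σ in (0 : ℝ)..τ, a (s + σ) * Z (σ, s))
      + ∫ σ in (0 : ℝ)..(max (τ - h) 0), b (s + h + σ) * Z (σ, s) := by
  have hM : 0 ≤ M := (norm_nonneg _).trans (haM 0)
  -- Any positive `l` with `2 * M / l ≤ 1 / 2` would do; `M + 1` keeps `l` positive when `M = 0`.
  set l : ℝ := 4 * (M + 1) with hldef
  have hl : 0 < l := by positivity
  have hq : 2 * M / l ≤ 1 / 2 := by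
    rw [div_le_iff₀ hl]; linarith
  have hone : ∀ p : ℝ × ℝ, ‖Real.exp (-(l * max p.1 0)) • (1 : R)‖ ≤ ‖(1 : R)‖ := by
    intro p
    rw [norm_smul, Real.norm_of_nonneg (Real.exp_nonneg _)]
    refine mul_le_of_le_one_left (norm_nonneg _) (Real.exp_le_one_iff.2 ?_)
    have : 0 ≤ l * max p.1 0 := mul_nonneg hl.le (le_max_right _ _)
    linarith
  let F : (ℝ × ℝ →ᵇ R) → (ℝ × ℝ →ᵇ R) := fun g =>
    BoundedContinuousFunction.ofNormedAddCommGroup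
      (fun p => Real.exp (-(l * max p.1 0)) • (1 : R) + volterraLin a b h l g p)
      (Continuous.add (by fun_prop) (continuous_volterraLin ha hb h l g.continuous))
      (‖(1 : R)‖ + 2 * (M * ‖g‖) / l)
      (fun p => (norm_add_le _ _).trans (add_le_add (hone p)
        (norm_volterraLin_le hh hl hM haM hbM (norm_nonneg g) g.norm_coe_le_norm p)))
  have hF : ContractingWith (1 / 2) F := by
    refine ⟨by rw [← NNReal.coe_lt_coe]; norm_num, LipschitzWith.of_dist_le_mul fun f g => ?_⟩
    rw [BoundedContinuousFunction.dist_le (by positivity)]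
    intro p
    have e : F f p - F g p = volterraLin a b h l (fun q => f q - g q) p := by
      rw [volterraLin_sub ha hb h l f.continuous g.continuous]
      simp [F]
    rw [dist_eq_norm, e]
    refine (norm_volterraLin_le hh hl hM haM hbM (dist_nonneg (x := f) (y := g))
      (fun q => ?_) p).trans ?_
    · rw [← dist_eq_norm]
      exact BoundedContinuousFunction.dist_coe_le_dist (f := f) (g := g) q
    · have : 2 * (M * dist f g) / l = 2 * M / l * dist f g := by ring
      rw [this]
      refine mul_le_mul_of_nonneg_right ?_ dist_nonneg
      simpa using hq
  set g := hF.fixedPoint with hg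
  have hfix : ∀ p, g p = Real.exp (-(l * max p.1 0)) • (1 : R) + volterraLin a b h l g p := by
    intro p
    exact congrArg (fun f : ℝ × ℝ →ᵇ R => f p) hF.fixedPoint_isFixedPt.symm
  -- The fixed point is the solution divided by the weight, so the weight is now restored.
  refine ⟨fun p => Real.exp (l * p.1) • g p, by fun_prop, fun τ s hτ => ?_⟩
  simp only [hfix (τ, s), volterraLin, max_eq_left hτ, ← smul_add, smul_smul, ← Real.exp_add,
    mul_smul_comm, add_neg_cancel, Real.exp_zero, one_smul]
  abel

/-- The differential form of the integral equation of the fundamental solution. -/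
theorem hasDerivAt_fundamental_solution [CompleteSpace R] {a b : ℝ → R} {h : ℝ}
    (ha : Continuous a) (hb : Continuous b) {Z : ℝ × ℝ → R} (hZ : Continuous Z)
    (hZeq : ∀ τ s, 0 ≤ τ → Z (τ, s) = 1
      + (∫ σ in (0 : ℝ)..τ, a (s + σ) * Z (σ, s))
      + ∫ σ in (0 : ℝ)..(max (τ - h) 0), b (s + h + σ) * Z (σ, s))
    {s t : ℝ} (hst : s < t) (hne : t ≠ s + h) :
    HasDerivAt (fun r => Z (r - s, s))
      (a t * Z (t - s, s) + b t * (if t - h < s then 0 else Z (t - h - s, s))) t := by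
  have hev : (fun r => Z (r - s, s)) =ᶠ[nhds t] fun r => 1
      + (∫ σ in (0 : ℝ)..(r - s), a (s + σ) * Z (σ, s))
      + ∫ σ in (0 : ℝ)..(max (r - s - h) 0), b (s + h + σ) * Z (σ, s) := by
    filter_upwards [Ioi_mem_nhds hst] with r hr
    exact hZeq (r - s) s (sub_nonneg.2 (le_of_lt hr))
  refine HasDerivAt.congr_of_eventuallyEq ?_ hev
  have c1 : Continuous fun σ => a (s + σ) * Z (σ, s) := by fun_prop
  have c2 : Continuous fun σ => b (s + h + σ) * Z (σ, s) := by fun_prop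
  have d1 : HasDerivAt (fun r => ∫ σ in (0 : ℝ)..(r - s), a (s + σ) * Z (σ, s))
      (a t * Z (t - s, s)) t := by
    have := (c1.integral_hasStrictDerivAt 0 (t - s)).hasDerivAt.comp_sub_const t s
    simpa using this
  have d2 : HasDerivAt
      (fun r => ∫ σ in (0 : ℝ)..(max (r - s - h) 0), b (s + h + σ) * Z (σ, s))
      (b t * (if t - h < s then 0 else Z (t - h - s, s))) t := by
    -- Away from `s + h` the truncation is locally trivial: the upper limit is `0` before that time,
    -- matching a kernel that vanishes before `s`, and `r - s - h` after it.
    rcases lt_or_gt_of_ne hne with hlt | hgt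
    · rw [if_pos (by linarith), mul_zero]
      refine (hasDerivAt_const t (0 : R)).congr_of_eventuallyEq ?_
      filter_upwards [Iio_mem_nhds hlt] with r hr
      simp only [mem_Iio] at hr
      rw [max_eq_right (by linarith), intervalIntegral.integral_same]
    · rw [if_neg (by linarith)]
      have := (c2.integral_hasStrictDerivAt 0 (t - (s + h))).hasDerivAt.comp_sub_const t (s + h)
      rw [show s + h + (t - (s + h)) = t by ring, show t - (s + h) = t - h - s by ring] at this
      refine this.congr_of_eventuallyEq ?_
      filter_upwards [Ioi_mem_nhds hgt] with r hr
      simp only [mem_Ioi] at hr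
      rw [max_eq_left (by linarith), show r - s - h = r - (s + h) by ring]
  exact (d1.const_add 1).add d2

end Volterra

/-! ### Gronwall's inequality with a delay. -/

section Gronwall

/-- A Gronwall inequality for delay equations with zero history. -/
theorem eq_zero_of_delay_integral_bound {E : Type*} [NormedAddCommGroup E] {d : ℝ → E}
    {t₀ b M h : ℝ} (hh : 0 ≤ h) (hM : 0 ≤ M) (hd0 : ∀ t, t < t₀ → d t = 0)
    (hd : ContinuousOn d (Icc t₀ b))
    (hbd : ∀ t ∈ Icc t₀ b, ‖d t‖ ≤ ∫ σ in t₀..t, M * (‖d σ‖ + ‖d (σ - h)‖)) :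
    ∀ t ∈ Icc t₀ b, d t = 0 := by
  intro t ht
  have htb : t₀ ≤ b := ht.1.trans ht.2
  have hn : ContinuousOn (fun σ => ‖d σ‖) (Icc t₀ b) := hd.norm
  have hint : ∀ c ∈ Icc t₀ b, IntervalIntegrable (fun σ => ‖d σ‖) volume t₀ c := fun c hc =>
    ContinuousOn.intervalIntegrable (by
      rw [uIcc_of_le hc.1]; exact hn.mono (Icc_subset_Icc_right hc.2))
  have hint0 : ∀ c, c ≤ t₀ → IntervalIntegrable (fun σ => ‖d σ‖) volume c t₀ := by
    intro c hc
    refine (intervalIntegrable_const (c := (0 : ℝ))).congr_ae ?_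
    have : ∀ᵐ x : ℝ, x ≠ t₀ := by simp [ae_iff, measure_singleton]
    rw [Filter.EventuallyEq, ae_restrict_iff' measurableSet_uIoc]
    filter_upwards [this] with x hx hx'
    rw [uIoc_of_le hc] at hx'
    rw [hd0 x (lt_of_le_of_ne hx'.2 hx), norm_zero]
  have hzero : ∀ c, c ≤ t₀ → ∫ σ in c..t₀, ‖d σ‖ = 0 := by
    intro c hc
    rw [intervalIntegral.integral_congr_ae (g := fun _ => (0 : ℝ))]
    · simp
    have : ∀ᵐ x : ℝ, x ≠ t₀ := by simp [ae_iff, measure_singleton]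
    filter_upwards [this] with x hx hx'
    rw [uIoc_of_le hc] at hx'
    rw [hd0 x (lt_of_le_of_ne hx'.2 hx), norm_zero]
  -- Since `d` vanishes before `t₀`, shifting the delayed integral by `h` bounds it by the undelayed
  -- one; the two together give the factor `2 * M`.
  have hbd2 : ∀ c ∈ Icc t₀ b, ‖d c‖ ≤ 2 * M * ∫ σ in t₀..c, ‖d σ‖ := by
    intro c hc
    have hsI : IntervalIntegrable (fun σ => ‖d (σ - h)‖) volume t₀ c := by
      have h1 : IntervalIntegrable (fun σ => ‖d σ‖) volume (t₀ - h) (c - h) := by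
        refine ((hint0 (t₀ - h) (by linarith)).trans (hint c hc)).mono_set ?_
        rw [uIcc_of_le (by linarith [hc.1]), uIcc_of_le (by linarith [hc.1])]
        exact Icc_subset_Icc_right (by linarith)
      simpa using h1.comp_sub_right h
    have e1 : ∫ σ in t₀..c, ‖d (σ - h)‖ ≤ ∫ σ in t₀..c, ‖d σ‖ := by
      rw [intervalIntegral.integral_comp_sub_right (fun x => ‖d x‖) h]
      have h2 := intervalIntegral.integral_add_adjacent_intervals
        (hint0 (t₀ - h) (by linarith)) (hint c hc)
      rw [hzero _ (by linarith), zero_add] at h2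
      rw [h2]
      refine intervalIntegral.integral_mono_interval le_rfl (by linarith [hc.1]) (by linarith)
        (.of_forall fun _ => norm_nonneg _) ((hint0 (t₀ - h) (by linarith)).trans (hint c hc))
    have h3 := hbd c hc
    rw [intervalIntegral.integral_const_mul, intervalIntegral.integral_add (hint c hc) hsI] at h3
    nlinarith
  have hder : ∀ x ∈ Ico t₀ b, HasDerivWithinAt (fun c => ∫ σ in t₀..c, ‖d σ‖) ‖d x‖ (Ici x) x := by
    intro x hx
    have hcw : ContinuousWithinAt (fun σ => ‖d σ‖) (Ici x) x :=
      (hn x (Ico_subset_Icc_self hx)).mono_of_mem_nhdsWithin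
        (Filter.mem_of_superset (Icc_mem_nhdsGE hx.2) (Icc_subset_Icc_left hx.1))
    refine intervalIntegral.integral_hasDerivWithinAt_right (hint x (Ico_subset_Icc_self hx))
      (s := Ici x) (t := Ioi x) ?_ (hcw.mono Ioi_subset_Ici_self)
    exact ⟨Ioc x b, Ioc_mem_nhdsGT hx.2,
      ((hn.mono (Ioc_subset_Icc_self.trans (Icc_subset_Icc_left hx.1))).aestronglyMeasurable
        measurableSet_Ioc)⟩
  have hcont : ContinuousOn (fun c => ∫ σ in t₀..c, ‖d σ‖) (Icc t₀ b) := by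
    have := intervalIntegral.continuousOn_primitive_interval (f := fun σ => ‖d σ‖) (a := t₀)
      (b := b) (μ := volume) (by rw [uIcc_of_le htb]; exact hn.integrableOn_Icc)
    rwa [uIcc_of_le htb] at this
  have hnn : ∀ c ∈ Icc t₀ b, 0 ≤ ∫ σ in t₀..c, ‖d σ‖ := fun c hc =>
    intervalIntegral.integral_nonneg hc.1 fun _ _ => norm_nonneg _
  -- Gronwall is applied to the primitive of `‖d‖`: it starts at `0` and its right derivative is at
  -- most `2 * M` times itself.
  have hG := norm_le_gronwallBound_of_norm_deriv_right_le (δ := 0) (K := 2 * M) (ε := 0)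
    hcont hder (by simp) (fun x hx => by
      have hx' := Ico_subset_Icc_self hx
      rw [norm_norm, Real.norm_of_nonneg (hnn x hx'), add_zero]
      exact hbd2 x hx') t ht
  rw [gronwallBound_ε0_δ0, Real.norm_of_nonneg (hnn t ht)] at hG
  have h4 := hbd2 t ht
  have h5 : ‖d t‖ ≤ 0 := h4.trans (mul_nonpos_of_nonneg_of_nonpos (by positivity) hG)
  simpa using h5

end Gronwall

/-! ### Real matrices as operators on `ℂⁿ`. -/

section Act

variable {n : ℕ}

theorem act_apply (A : Mat n) (v : Vec n) (i : Fin n) :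
    act A v i = ∑ j, (A i j : ℂ) * v j := by
  simp [act, Matrix.mulVec, dotProduct]

theorem act_mul (A B : Mat n) : act (A * B) = act A * act B := by
  have : (A * B).map (fun r : ℝ => (r : ℂ)) =
      A.map (fun r : ℝ => (r : ℂ)) * B.map (fun r => (r : ℂ)) :=
    Matrix.map_mul (f := Complex.ofRealHom)
  rw [act, this, map_mul, act, act]

theorem act_mul_apply (A B : Mat n) (v : Vec n) : act (A * B) v = act A (act B v) := by
  rw [act_mul]; rfl

theorem act_one : act (1 : Mat n) = 1 := by
  have : (1 : Mat n).map (fun r : ℝ => (r : ℂ)) = 1 :=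
    Matrix.map_one Complex.ofRealHom (map_zero _) (map_one _)
  rw [act, this, map_one]

/-- The action of matrices as a real-linear map. -/
def actLM (n : ℕ) : Mat n →ₗ[ℝ] (Vec n →L[ℂ] Vec n) where
  toFun := act
  map_add' A B := by
    ext v i; simp [act_apply, add_mul, Finset.sum_add_distrib]
  map_smul' c A := by
    ext v i; simp [act_apply, Finset.mul_sum, mul_assoc]

theorem act_zero : act (0 : Mat n) = 0 := (actLM n).map_zero

theorem act_add (A B : Mat n) : act (A + B) = act A + act B := (actLM n).map_add A B

theorem act_transpose (A : Mat n) : act A.transpose = ContinuousLinearMap.adjoint (act A) := by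
  have : A.transpose.map (fun r : ℝ => (r : ℂ)) = star (A.map (fun r : ℝ => (r : ℂ))) := by
    ext i j; simp [Matrix.star_apply]
  rw [act, this, map_star]; rfl

theorem inner_act_transpose (A : Mat n) (u v : Vec n) :
    inner ℂ u (act A.transpose v) = inner ℂ (act A u) v := by
  rw [act_transpose, ContinuousLinearMap.adjoint_inner_right]

theorem continuous_act : Continuous (act : Mat n → Vec n →L[ℂ] Vec n) :=
  (actLM n).continuous_of_finiteDimensional

/-- Reduces integrals and derivatives of operator-valued functions to those of real entries, without
a norm on matrices. -/
theorem act_eq_sum (A : Mat n) :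
    act A = ∑ i, ∑ j, A i j • act (Matrix.single i j (1 : ℝ)) := by
  conv_lhs => rw [Matrix.matrix_eq_sum_single A]
  change actLM n _ = _
  simp only [map_sum]
  refine Finset.sum_congr rfl fun i _ => Finset.sum_congr rfl fun j _ => ?_
  change _ = A i j • actLM n (Matrix.single i j (1 : ℝ))
  rw [← map_smul, Matrix.smul_single, smul_eq_mul, mul_one]

theorem act_injective : Function.Injective (act : Mat n → Vec n →L[ℂ] Vec n) := by
  intro A B hAB
  ext i j
  have := congrArg (fun L : Vec n →L[ℂ] Vec n => L (EuclideanSpace.single j 1) i) hAB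
  simpa [act_apply] using this

theorem intervalIntegral_sum_smul {E ι κ : Type*} [Fintype ι] [Fintype κ] [NormedAddCommGroup E]
    [NormedSpace ℝ E] [CompleteSpace E] {a b : ℝ} {f : ι → κ → ℝ → ℝ} (e : ι → κ → E)
    (hf : ∀ i j, IntervalIntegrable (f i j) volume a b) :
    ∫ t in a..b, ∑ i, ∑ j, f i j t • e i j = ∑ i, ∑ j, (∫ t in a..b, f i j t) • e i j := by
  have hs : ∀ i j, IntervalIntegrable (fun t => f i j t • e i j) volume a b :=
    fun i j => ⟨(hf i j).1.smul_const _, (hf i j).2.smul_const _⟩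
  rw [intervalIntegral.integral_finsetSum fun i _ =>
    ⟨integrable_finsetSum _ fun j _ => (hs i j).1, integrable_finsetSum _ fun j _ => (hs i j).2⟩]
  refine Finset.sum_congr rfl fun i _ => ?_
  rw [intervalIntegral.integral_finsetSum fun j _ => hs i j]
  exact Finset.sum_congr rfl fun j _ => intervalIntegral.integral_smul_const _ _

theorem hasDerivAt_sum_smul {E ι κ : Type*} [Fintype ι] [Fintype κ] [NormedAddCommGroup E]
    [NormedSpace ℝ E] {t : ℝ} {f : ι → κ → ℝ → ℝ} {f' : ι → κ → ℝ} (e : ι → κ → E)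
    (hf : ∀ i j, HasDerivAt (f i j) (f' i j) t) :
    HasDerivAt (fun r => ∑ i, ∑ j, f i j r • e i j) (∑ i, ∑ j, f' i j • e i j) t :=
  HasDerivAt.fun_sum fun i _ => HasDerivAt.fun_sum fun j _ => (hf i j).smul_const _

theorem act_matIntegral {a b : ℝ} {F : ℝ → Mat n}
    (hF : ∀ i j, IntervalIntegrable (fun t => F t i j) volume a b) :
    act (matIntegral a b F) = ∫ t in a..b, act (F t) := by
  have e := intervalIntegral_sum_smul
    (fun i j => act (Matrix.single i j (1 : ℝ))) (f := fun i j t => F t i j) hF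
  have e' : (fun t => act (F t)) =
      fun t => ∑ i, ∑ j, F t i j • act (Matrix.single i j (1 : ℝ)) :=
    funext fun t => act_eq_sum (F t)
  rw [act_eq_sum, e', e]
  rfl

theorem hasDerivAt_act {F : ℝ → Mat n} {F' : Mat n} {t : ℝ}
    (hF : ∀ i j, HasDerivAt (fun r => F r i j) (F' i j) t) :
    HasDerivAt (fun r => act (F r)) (act F') t := by
  have e : (fun r => act (F r)) =
      fun r => ∑ i, ∑ j, F r i j • act (Matrix.single i j (1 : ℝ)) :=
    funext fun r => act_eq_sum (F r)
  rw [e, act_eq_sum F']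
  exact hasDerivAt_sum_smul (fun i j => act (Matrix.single i j (1 : ℝ))) hF

theorem exists_norm_act_le {A : ℝ → Mat n} {T : ℝ} (hT : 0 < T) (hA : Continuous A)
    (hAT : Function.Periodic A T) : ∃ M, 0 ≤ M ∧ ∀ t, ‖act (A t)‖ ≤ M := by
  obtain ⟨M, hM⟩ := (isCompact_Icc (a := (0 : ℝ)) (b := T)).exists_bound_of_continuousOn
    (continuous_act.comp hA).continuousOn
  refine ⟨max M 0, le_max_right _ _, fun t => le_max_of_le_left ?_⟩
  obtain ⟨y, hy, e⟩ := hAT.exists_mem_Ico₀ hT t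
  rw [e]
  exact hM y (Ico_subset_Icc_self hy)

end Act

/-! ### Functions that vanish before a given time. -/

section Causal

variable {E : Type*} [NormedAddCommGroup E]

/-- A jump at `s` is allowed, since it affects a single point of measure zero; `K(·, s)` has such a
jump. -/
theorem intervalIntegrable_of_eq_zero_before {g : ℝ → E} {s : ℝ} (h0 : ∀ t, t < s → g t = 0)
    (hg : ContinuousOn g (Ici s)) (a b : ℝ) : IntervalIntegrable g volume a b := by
  have key : ∀ c, IntervalIntegrable g volume s c := by
    intro c
    rcases le_total s c with hc | hc
    · exact ContinuousOn.intervalIntegrable (by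
        rw [uIcc_of_le hc]; exact hg.mono Icc_subset_Ici_self)
    · refine (intervalIntegrable_const (c := (0 : E))).congr_ae ?_
      have : ∀ᵐ x : ℝ, x ≠ s := by simp [ae_iff, measure_singleton]
      rw [Filter.EventuallyEq, ae_restrict_iff' measurableSet_uIoc]
      filter_upwards [this] with x hx hx'
      rw [uIoc_of_ge hc] at hx'
      rw [h0 x (lt_of_le_of_ne hx'.2 hx)]
  exact (key a).symm.trans (key b)

end Causal

/-! ### Existence and uniqueness of the fundamental matrix. -/

section Fundamental

variable {n : ℕ} {A₀ A₁ : ℝ → Mat n} {h : ℝ} {K : ℝ → ℝ → Mat n}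

theorem IsFundamentalMatrix.intervalIntegrable_act (hK : IsFundamentalMatrix A₀ A₁ h K)
    (hA₀ : Continuous A₀) (hA₁ : Continuous A₁) (s a b : ℝ) :
    IntervalIntegrable (fun σ => act (A₀ σ * K σ s)) volume a b ∧
    IntervalIntegrable (fun σ => act (A₁ σ * K (σ - h) s)) volume a b := by
  constructor
  · refine intervalIntegrable_of_eq_zero_before (s := s) (fun t ht => ?_) ?_ a b
    · rw [hK.before s t ht, mul_zero, act_zero]
    · exact continuous_act.comp_continuousOn (hA₀.continuousOn.mul (hK.cont s))
  · refine intervalIntegrable_of_eq_zero_before (s := s + h) (fun t ht => ?_) ?_ a b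
    · rw [hK.before s _ (by linarith), mul_zero, act_zero]
    · refine continuous_act.comp_continuousOn (hA₁.continuousOn.mul ?_)
      refine (hK.cont s).comp (by fun_prop) fun t ht => ?_
      simp only [mem_Ici] at ht ⊢; linarith

/-- The integral form of the equation of the fundamental matrix. -/
theorem IsFundamentalMatrix.act_eq_integral (hK : IsFundamentalMatrix A₀ A₁ h K)
    (hA₀ : Continuous A₀) (hA₁ : Continuous A₁) {s t : ℝ} (hst : s ≤ t) :
    act (K t s) = 1 + ∫ σ in s..t, act (A₀ σ * K σ s + A₁ σ * K (σ - h) s) := by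
  have hint := hK.intervalIntegrable_act hA₀ hA₁ s s t
  -- The fundamental theorem of calculus tolerates the one exceptional time `s + h`.
  rw [integral_eq_of_hasDerivAt_off_countable_of_le (fun t => act (K t s)) _ hst
    (countable_singleton (s + h))
    (continuous_act.comp_continuousOn ((hK.cont s).mono Icc_subset_Ici_self))
    (fun r hr => hasDerivAt_act (hK.equation s r hr.1.1 hr.2)) ?_]
  · rw [hK.diag, act_one]; abel
  · simp only [act_add]; exact hint.1.add hint.2

/-- The difference of two fundamental matrices vanishes before `s` and, by the integral form,
satisfies the delay Gronwall bound. -/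
theorem IsFundamentalMatrix.unique (hh : 0 ≤ h) (hA₀ : Continuous A₀) (hA₁ : Continuous A₁)
    {M : ℝ} (hM₀ : ∀ t, ‖act (A₀ t)‖ ≤ M) (hM₁ : ∀ t, ‖act (A₁ t)‖ ≤ M) {K' : ℝ → ℝ → Mat n}
    (hK : IsFundamentalMatrix A₀ A₁ h K) (hK' : IsFundamentalMatrix A₀ A₁ h K') : K = K' := by
  ext1 t; ext1 s
  rcases lt_or_ge t s with hts | hts
  · rw [hK.before s t hts, hK'.before s t hts]
  have hM : 0 ≤ M := (norm_nonneg _).trans (hM₀ 0)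
  apply act_injective
  rw [← sub_eq_zero]
  have hdc : ContinuousOn (fun r => act (K r s) - act (K' r s)) (Ici s) :=
    (continuous_act.comp_continuousOn (hK.cont s)).sub
      (continuous_act.comp_continuousOn (hK'.cont s))
  have hd0 : ∀ r, r < s → act (K r s) - act (K' r s) = 0 := fun r hr => by
    rw [hK.before s r hr, hK'.before s r hr, sub_self]
  refine eq_zero_of_delay_integral_bound (d := fun r => act (K r s) - act (K' r s)) (t₀ := s)
    (b := t) hh hM hd0 (hdc.mono Icc_subset_Ici_self) (fun c hc => ?_) t ⟨hts, le_rfl⟩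
  have h1 := hK.intervalIntegrable_act hA₀ hA₁ s s c
  have h2 := hK'.intervalIntegrable_act hA₀ hA₁ s s c
  beta_reduce
  rw [hK.act_eq_integral hA₀ hA₁ hc.1, hK'.act_eq_integral hA₀ hA₁ hc.1, add_sub_add_left_eq_sub,
    ← intervalIntegral.integral_sub]
  · refine intervalIntegral.norm_integral_le_of_norm_le hc.1 (.of_forall fun σ _ => ?_) ?_
    · have e : act (A₀ σ * K σ s + A₁ σ * K (σ - h) s) - act (A₀ σ * K' σ s + A₁ σ * K' (σ - h) s)
          = act (A₀ σ) * (act (K σ s) - act (K' σ s))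
            + act (A₁ σ) * (act (K (σ - h) s) - act (K' (σ - h) s)) := by
        simp only [act_add, act_mul, mul_sub]; abel
      rw [e, mul_add]
      refine (norm_add_le _ _).trans (add_le_add ?_ ?_) <;>
      refine (norm_mul_le _ _).trans ?_ <;> gcongr
      · exact hM₀ σ
      · exact hM₁ σ
    · have g1 := intervalIntegrable_of_eq_zero_before hd0 hdc
      have g2 := (g1 (s - h) (c - h)).comp_sub_right h
      simp only [sub_add_cancel] at g2
      exact ((g1 s c).norm.add g2.norm).const_mul M
  · simp only [act_add]; exact h1.1.add h1.2
  · simp only [act_add]; exact h2.1.add h2.2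

-- A submultiplicative norm makes `Mat n` a Banach algebra, the setting of the Volterra
-- construction.
attribute [local instance] Matrix.linftyOpNormedRing Matrix.linftyOpNormedAlgebra

theorem exists_norm_le_of_periodic {A : ℝ → Mat n} {T : ℝ} (hT : 0 < T) (hA : Continuous A)
    (hAT : Function.Periodic A T) : ∃ M, ∀ t, ‖A t‖ ≤ M := by
  obtain ⟨M, hM⟩ := (isCompact_Icc (a := (0 : ℝ)) (b := T)).exists_bound_of_continuousOn
    hA.continuousOn
  refine ⟨M, fun t => ?_⟩
  obtain ⟨y, hy, e⟩ := hAT.exists_mem_Ico₀ hT t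
  rw [e]
  exact hM y (Ico_subset_Icc_self hy)

/-- In elapsed time `t - s` and initial time `s`, the solution is continuous on the whole plane; the
only discontinuity of `K` then comes from the cut at `t < s`. -/
theorem exists_isFundamentalMatrix {T : ℝ} (hh : 0 ≤ h) (hT : 0 < T)
    (hA₀ : Continuous A₀) (hA₀T : Function.Periodic A₀ T)
    (hA₁ : Continuous A₁) (hA₁T : Function.Periodic A₁ T) :
    ∃ Z : ℝ × ℝ → Mat n, Continuous Z ∧
      IsFundamentalMatrix A₀ A₁ h (fun t s => if t < s then 0 else Z (t - s, s)) := by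
  obtain ⟨M₀, hM₀⟩ := exists_norm_le_of_periodic hT hA₀ hA₀T
  obtain ⟨M₁, hM₁⟩ := exists_norm_le_of_periodic hT hA₁ hA₁T
  obtain ⟨Z, hZ, hZeq⟩ := exists_fundamental_solution (M := max M₀ M₁) hh hA₀ hA₁
    (fun t => (hM₀ t).trans (le_max_left _ _)) (fun t => (hM₁ t).trans (le_max_right _ _))
  refine ⟨Z, hZ, ⟨fun s t hts => if_pos hts, fun s => ?_, fun s => ?_, fun s t hst hne i j => ?_⟩⟩
  · have := hZeq 0 s le_rfl
    simp only [lt_self_iff_false, if_false, sub_self]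
    simpa [hh] using this
  · have : ContinuousOn (fun t => Z (t - s, s)) (Ici s) := by fun_prop
    refine this.congr fun t ht => if_neg (not_lt.2 ht)
  · have hd := hasDerivAt_fundamental_solution hA₀ hA₁ hZ hZeq hst hne
    have he := ((Matrix.entryLinearMap ℝ ℝ i j :
      Mat n →ₗ[ℝ] ℝ).toContinuousLinearMap.hasFDerivAt.comp_hasDerivAt t hd)
    simp only [if_neg (not_lt.2 hst.le)]
    refine HasDerivAt.congr_of_eventuallyEq he ?_
    filter_upwards [Ioi_mem_nhds hst] with r hr
    simp only [if_neg (not_lt.2 (le_of_lt (mem_Ioi.1 hr)))]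
    rfl

end Fundamental

/-! ### Regularity of the chosen fundamental matrix. -/

section FundMatrix

variable {n : ℕ} {A₀ A₁ : ℝ → Mat n} {h T : ℝ}

theorem fundMatrix_isFundamentalMatrix (hh : 0 ≤ h) (hT : 0 < T)
    (hA₀ : Continuous A₀) (hA₀T : Function.Periodic A₀ T)
    (hA₁ : Continuous A₁) (hA₁T : Function.Periodic A₁ T) :
    IsFundamentalMatrix A₀ A₁ h (fundMatrix A₀ A₁ h) := by
  obtain ⟨Z, -, hZ⟩ := exists_isFundamentalMatrix hh hT hA₀ hA₀T hA₁ hA₁T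
  exact Classical.epsilon_spec ⟨_, hZ⟩

/-- The defining properties say nothing about the dependence on `s`. Uniqueness transfers the joint
continuity of the constructed `Z` to `fundMatrix`, whence joint measurability and bounds. -/
theorem exists_fundMatrix_eq (hh : 0 ≤ h) (hT : 0 < T)
    (hA₀ : Continuous A₀) (hA₀T : Function.Periodic A₀ T)
    (hA₁ : Continuous A₁) (hA₁T : Function.Periodic A₁ T) :
    ∃ Z : ℝ × ℝ → Mat n, Continuous Z ∧
      ∀ t s, fundMatrix A₀ A₁ h t s = if t < s then 0 else Z (t - s, s) := by
  obtain ⟨Z, hZc, hZ⟩ := exists_isFundamentalMatrix hh hT hA₀ hA₀T hA₁ hA₁T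
  obtain ⟨M₀, -, hM₀⟩ := exists_norm_act_le hT hA₀ hA₀T
  obtain ⟨M₁, -, hM₁⟩ := exists_norm_act_le hT hA₁ hA₁T
  have := (fundMatrix_isFundamentalMatrix hh hT hA₀ hA₀T hA₁ hA₁T).unique (M := max M₀ M₁)
    hh hA₀ hA₁ (fun t => (hM₀ t).trans (le_max_left _ _))
    (fun t => (hM₁ t).trans (le_max_right _ _)) hZ
  exact ⟨Z, hZc, fun t s => by rw [this]⟩

theorem measurable_fundMatrix (hh : 0 ≤ h) (hT : 0 < T)
    (hA₀ : Continuous A₀) (hA₀T : Function.Periodic A₀ T)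
    (hA₁ : Continuous A₁) (hA₁T : Function.Periodic A₁ T) :
    StronglyMeasurable fun p : ℝ × ℝ => act (fundMatrix A₀ A₁ h p.1 p.2) := by
  obtain ⟨Z, hZ, e⟩ := exists_fundMatrix_eq hh hT hA₀ hA₀T hA₁ hA₁T
  have e' : (fun p : ℝ × ℝ => act (fundMatrix A₀ A₁ h p.1 p.2)) =
      fun p : ℝ × ℝ => if p.1 < p.2 then 0 else act (Z (p.1 - p.2, p.2)) := by
    ext1 p
    rw [e]
    split_ifs
    · exact act_zero
    · rfl
  rw [e']
  refine StronglyMeasurable.ite (measurableSet_lt measurable_fst measurable_snd)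
    stronglyMeasurable_const ?_
  exact (continuous_act.comp (hZ.comp (by fun_prop))).stronglyMeasurable

/-- Only `0 ≤ s ≤ t ≤ b` matters, and there `(t - s, s)` lies in a compact square. -/
theorem exists_norm_fundMatrix_le (hh : 0 ≤ h) (hT : 0 < T)
    (hA₀ : Continuous A₀) (hA₀T : Function.Periodic A₀ T)
    (hA₁ : Continuous A₁) (hA₁T : Function.Periodic A₁ T) (b : ℝ) :
    ∃ C, 0 ≤ C ∧ ∀ t s, t ≤ b → 0 ≤ s → ‖act (fundMatrix A₀ A₁ h t s)‖ ≤ C := by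
  obtain ⟨Z, hZ, e⟩ := exists_fundMatrix_eq hh hT hA₀ hA₀T hA₁ hA₁T
  obtain ⟨C, hC⟩ := ((isCompact_Icc (a := (0 : ℝ)) (b := b)).prod
    (isCompact_Icc (a := (0 : ℝ)) (b := b))).exists_bound_of_continuousOn
    (continuous_act.comp hZ).continuousOn
  refine ⟨max C 0, le_max_right _ _, fun t s ht hs => ?_⟩
  rw [e]
  split_ifs with hts
  · rw [act_zero, norm_zero]; exact le_max_right _ _
  · rw [not_lt] at hts
    exact (hC (t - s, s) ⟨⟨by linarith, by simp only; linarith⟩,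
      ⟨hs, by simp only; linarith⟩⟩).trans (le_max_left _ _)

/-- The integral form of the equation of the fundamental matrix, from the time `0` on. -/
theorem fundMatrix_eq_integral (hh : 0 ≤ h) (hT : 0 < T)
    (hA₀ : Continuous A₀) (hA₀T : Function.Periodic A₀ T)
    (hA₁ : Continuous A₁) (hA₁T : Function.Periodic A₁ T) {t s : ℝ} (hs : 0 ≤ s) (ht : 0 ≤ t) :
    act (fundMatrix A₀ A₁ h t s) = (if s ≤ t then 1 else 0) + ∫ σ in (0 : ℝ)..t,
      (act (A₀ σ) * act (fundMatrix A₀ A₁ h σ s)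
        + act (A₁ σ) * act (fundMatrix A₀ A₁ h (σ - h) s)) := by
  have hK := fundMatrix_isFundamentalMatrix hh hT hA₀ hA₀T hA₁ hA₁T
  set K := fundMatrix A₀ A₁ h
  have hz : ∀ σ, σ < s → act (A₀ σ) * act (K σ s) + act (A₁ σ) * act (K (σ - h) s) = 0 := by
    intro σ hσ
    rw [hK.before s σ hσ, hK.before s (σ - h) (by linarith), act_zero]; simp
  have hz' : ∀ c, 0 ≤ c → c ≤ s →
      ∫ σ in (0 : ℝ)..c, (act (A₀ σ) * act (K σ s) + act (A₁ σ) * act (K (σ - h) s)) = 0 := by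
    intro c h0 hc
    rw [intervalIntegral.integral_congr_ae (g := fun _ => 0)]
    · simp
    have : ∀ᵐ x : ℝ, x ≠ s := by simp [ae_iff, measure_singleton]
    filter_upwards [this] with x hx hx'
    rw [uIoc_of_le h0] at hx'
    exact hz x (lt_of_le_of_ne (hx'.2.trans hc) hx)
  rcases lt_or_ge t s with hts | hts
  · rw [if_neg (not_le.2 hts), hK.before s t hts, hz' t ht hts.le, act_zero, add_zero]
  · have hint := fun a b => hK.intervalIntegrable_act hA₀ hA₁ s a b
    simp only [act_mul] at hint
    rw [if_pos hts, hK.act_eq_integral hA₀ hA₁ hts,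
      ← intervalIntegral.integral_add_adjacent_intervals ((hint 0 s).1.add (hint 0 s).2)
        ((hint s t).1.add (hint s t).2), hz' s hs le_rfl, zero_add]
    simp only [act_add, act_mul]

end FundMatrix

/-! ### Integrability of bounded operator kernels applied to integrable functions. -/

section Kernel

variable {α β V F : Type*} [MeasurableSpace α] [MeasurableSpace β]
  [NormedAddCommGroup V] [NormedSpace ℂ V] [NormedAddCommGroup F] [NormedSpace ℂ F]

theorem aestronglyMeasurable_clm_apply {μ : Measure α} {N : α → V →L[ℂ] F} {f : α → V}
    (hN : AEStronglyMeasurable N μ) (hf : AEStronglyMeasurable f μ) :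
    AEStronglyMeasurable (fun a => N a (f a)) μ :=
  (ContinuousLinearMap.apply ℂ F (E := V)).aestronglyMeasurable_comp₂ hf hN

theorem integrable_clm_apply {μ : Measure α} {N : α → V →L[ℂ] F} {f : α → V} {C : ℝ}
    (hN : AEStronglyMeasurable N μ) (hC : ∀ᵐ a ∂μ, ‖N a‖ ≤ C) (hf : Integrable f μ) :
    Integrable (fun a => N a (f a)) μ := by
  refine (hf.norm.const_mul C).mono' (aestronglyMeasurable_clm_apply hN hf.aestronglyMeasurable) ?_
  filter_upwards [hC] with a ha
  exact (N a).le_of_opNorm_le ha _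

theorem integrable_kernel_apply {μ : Measure α} {ρ : Measure β} [SFinite μ] [IsFiniteMeasure ρ]
    {N : α × β → V →L[ℂ] F} {f : α → V} {C : ℝ}
    (hN : AEStronglyMeasurable N (μ.prod ρ)) (hC : ∀ᵐ p ∂(μ.prod ρ), ‖N p‖ ≤ C)
    (hf : Integrable f μ) : Integrable (fun p => N p (f p.1)) (μ.prod ρ) :=
  integrable_clm_apply hN hC (hf.comp_fst ρ)

end Kernel

/-! ### The measure joining the point value and the history. -/

section AtomMeasure

/-- Lebesgue measure on `(-h, 0]` together with a unit point mass at `-h`. -/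
def atomMeasure (h : ℝ) : Measure ℝ := Measure.dirac (-h) + volume.restrict (Ioc (-h) 0)

instance (h : ℝ) : IsFiniteMeasure (atomMeasure h) := by
  unfold atomMeasure; infer_instance

theorem ae_atomMeasure {h : ℝ} {p : ℝ → Prop} :
    (∀ᵐ ξ ∂(atomMeasure h), p ξ) ↔ p (-h) ∧ ∀ᵐ ξ ∂(volume.restrict (Ioc (-h) 0)), p ξ := by
  rw [atomMeasure, ae_add_measure_iff, ae_dirac_eq, Filter.eventually_pure]

theorem ae_atomMeasure_mem_Icc {h : ℝ} (hh : 0 ≤ h) : ∀ᵐ ξ ∂(atomMeasure h), ξ ∈ Icc (-h) 0 :=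
  ae_atomMeasure.2 ⟨⟨le_rfl, by linarith⟩,
    (ae_restrict_mem measurableSet_Ioc).mono fun _ hξ => Ioc_subset_Icc_self hξ⟩

variable {E : Type*} [NormedAddCommGroup E]

theorem integrable_atomMeasure {h : ℝ} {g : ℝ → E} :
    Integrable g (atomMeasure h) ↔ IntegrableOn g (Ioc (-h) 0) := by
  rw [atomMeasure, integrable_add_measure]
  exact ⟨fun H => H.2, fun H => ⟨integrable_dirac (by simp), H⟩⟩

theorem integral_atomMeasure [NormedSpace ℝ E] [CompleteSpace E] {h : ℝ} (hh : 0 ≤ h) {g : ℝ → E}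
    (hg : IntegrableOn g (Ioc (-h) 0)) :
    ∫ ξ, g ξ ∂(atomMeasure h) = g (-h) + ∫ ξ in (-h)..0, g ξ := by
  rw [atomMeasure, integral_add_measure (integrable_dirac (by simp)) hg, integral_dirac,
    intervalIntegral.integral_of_le (by linarith)]

theorem ae_histMeasure_iff {h : ℝ} {p : ℝ → Prop} :
    (∀ᵐ ξ ∂(histMeasure h), p ξ) ↔ ∀ᵐ ξ ∂(volume.restrict (Ioc (-h) 0)), p ξ := by
  rw [histMeasure, restrict_Ioc_eq_restrict_Icc]

end AtomMeasure

/-! ### The density that encodes a state. -/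

section Input

variable {n : ℕ} {h : ℝ}

/-- The data through which the initial state enters the solution formula, as a density with
respect to `atomMeasure h`. -/
def inputFun (A₁ : ℝ → Mat n) (φ : State n h) (ξ : ℝ) : Vec n :=
  if ξ = -h then φ.fst else act (A₁ (h + ξ)) (φ.snd ξ)

theorem inputFun_atom (A₁ : ℝ → Mat n) (φ : State n h) : inputFun A₁ φ (-h) = φ.fst := if_pos rfl

theorem inputFun_of_mem (A₁ : ℝ → Mat n) (φ : State n h) {ξ : ℝ} (hξ : ξ ∈ Ioc (-h) 0) :
    inputFun A₁ φ ξ = act (A₁ (h + ξ)) (φ.snd ξ) := if_neg hξ.1.ne'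

theorem integrableOn_snd (φ : State n h) : IntegrableOn (φ.snd : ℝ → Vec n) (Ioc (-h) 0) := by
  have : Integrable (φ.snd : ℝ → Vec n) (histMeasure h) :=
    (Lp.memLp φ.snd).integrable one_le_two
  exact IntegrableOn.mono_set this Ioc_subset_Icc_self

theorem integrableOn_act_snd {A : ℝ → Mat n} (hA : ContinuousOn A (Icc (-h) 0)) (φ : State n h) :
    IntegrableOn (fun ξ => act (A ξ) (φ.snd ξ)) (Ioc (-h) 0) := by
  have hc : ContinuousOn (fun ξ => act (A ξ)) (Icc (-h) 0) := continuous_act.comp_continuousOn hA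
  obtain ⟨C, hC⟩ := isCompact_Icc.exists_bound_of_continuousOn hc
  refine integrable_clm_apply (C := C) ((hc.mono Ioc_subset_Icc_self).aestronglyMeasurable
    measurableSet_Ioc) ?_ (integrableOn_snd φ)
  exact (ae_restrict_mem measurableSet_Ioc).mono fun ξ hξ => hC ξ (Ioc_subset_Icc_self hξ)

theorem integrable_inputFun {A₁ : ℝ → Mat n} (hA₁ : Continuous A₁) (φ : State n h) :
    Integrable (inputFun A₁ φ) (atomMeasure h) := by
  rw [integrable_atomMeasure]
  refine (integrableOn_act_snd (A := fun ξ => A₁ (h + ξ)) (by fun_prop) φ).congr_fun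
    (fun ξ hξ => (inputFun_of_mem A₁ φ hξ).symm) measurableSet_Ioc

end Input

/-! ### The variation of constants formula. -/

section Mild

variable {n : ℕ} {A₀ A₁ : ℝ → Mat n} {h T : ℝ}

/-- The standing assumptions on the coefficients of the delay equation. -/
structure IsAdmissible (A₀ A₁ : ℝ → Mat n) (h T : ℝ) : Prop where
  nonneg : 0 ≤ h
  pos : 0 < T
  cont₀ : Continuous A₀
  per₀ : Function.Periodic A₀ T
  cont₁ : Continuous A₁
  per₁ : Function.Periodic A₁ T

namespace IsAdmissible

theorem isFundamentalMatrix (H : IsAdmissible A₀ A₁ h T) :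
    IsFundamentalMatrix A₀ A₁ h (fundMatrix A₀ A₁ h) :=
  fundMatrix_isFundamentalMatrix H.nonneg H.pos H.cont₀ H.per₀ H.cont₁ H.per₁

theorem stronglyMeasurable_act_fundMatrix (H : IsAdmissible A₀ A₁ h T) {γ : Type*}
    [MeasurableSpace γ] {u v : γ → ℝ} (hu : Measurable u) (hv : Measurable v) :
    StronglyMeasurable fun c => act (fundMatrix A₀ A₁ h (u c) (v c)) := by
  have h1 := measurable_fundMatrix H.nonneg H.pos H.cont₀ H.per₀ H.cont₁ H.per₁
  exact h1.comp_measurable (g := fun c => (u c, v c)) (hu.prodMk hv)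

theorem exists_norm_le (H : IsAdmissible A₀ A₁ h T) (b : ℝ) :
    ∃ C, 0 ≤ C ∧ ∀ t s, t ≤ b → 0 ≤ s → ‖act (fundMatrix A₀ A₁ h t s)‖ ≤ C :=
  exists_norm_fundMatrix_le H.nonneg H.pos H.cont₀ H.per₀ H.cont₁ H.per₁ b

end IsAdmissible

/-- The solution of the delay equation for `t ≥ 0` by the variation of constants formula. -/
def mildSol (A₀ A₁ : ℝ → Mat n) (φ : State n h) (t : ℝ) : Vec n :=
  ∫ ξ, act (fundMatrix A₀ A₁ h t (h + ξ)) (inputFun A₁ φ ξ) ∂(atomMeasure h)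

theorem IsAdmissible.integrable_fundMatrix_inputFun (H : IsAdmissible A₀ A₁ h T) (φ : State n h)
    (t : ℝ) : Integrable (fun ξ => act (fundMatrix A₀ A₁ h t (h + ξ)) (inputFun A₁ φ ξ))
      (atomMeasure h) := by
  obtain ⟨C, -, hC⟩ := H.exists_norm_le t
  refine integrable_clm_apply (C := C) (H.stronglyMeasurable_act_fundMatrix (by fun_prop)
    (by fun_prop)).aestronglyMeasurable ?_ (integrable_inputFun H.cont₁ φ)
  filter_upwards [ae_atomMeasure_mem_Icc H.nonneg] with ξ hξ
  exact hC _ _ le_rfl (by linarith [hξ.1])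

theorem IsAdmissible.mildSol_of_neg (H : IsAdmissible A₀ A₁ h T) (φ : State n h) {t : ℝ}
    (ht : t < 0) : mildSol A₀ A₁ φ t = 0 := by
  refine integral_eq_zero_of_ae ?_
  filter_upwards [ae_atomMeasure_mem_Icc H.nonneg] with ξ hξ
  rw [H.isFundamentalMatrix.before _ _ (by linarith [hξ.1]), act_zero]
  rfl

/-- The history part of the state, extended by zero. -/
def histFun (φ : State n h) : ℝ → Vec n := (Ioo (-h) 0).indicator (φ.snd : ℝ → Vec n)

theorem integrable_histFun (φ : State n h) : Integrable (histFun φ) := by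
  unfold histFun
  rw [integrable_indicator_iff measurableSet_Ioo]
  exact (integrableOn_snd φ).mono_set Ioo_subset_Ioc_self

theorem IsAdmissible.intervalIntegrable_act_histFun (H : IsAdmissible A₀ A₁ h T) (φ : State n h)
    (a b : ℝ) :
    IntervalIntegrable (fun σ => act (A₁ σ) (histFun φ (σ - h))) volume a b := by
  obtain ⟨M, -, hM⟩ := exists_norm_act_le H.pos H.cont₁ H.per₁
  refine Integrable.intervalIntegrable ?_
  exact integrable_clm_apply (C := M)
    (continuous_act.comp H.cont₁).aestronglyMeasurable (.of_forall hM)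
    ((integrable_histFun φ).comp_sub_right h)

/-- This is the contribution of the starting value `1` of each column `K(·, h + ξ)`: summed over the
start times up to `t`, it produces the initial value and the forcing by the history. -/
theorem IsAdmissible.integral_inputFun_ite (H : IsAdmissible A₀ A₁ h T) (φ : State n h) {t : ℝ}
    (ht : 0 ≤ t) :
    ∫ ξ, (if h + ξ ≤ t then inputFun A₁ φ ξ else 0) ∂(atomMeasure h)
      = φ.fst + ∫ σ in (0 : ℝ)..t, act (A₁ σ) (histFun φ (σ - h)) := by
  have hm : MeasurableSet {ξ : ℝ | h + ξ ≤ t} := measurableSet_le (by fun_prop) (by fun_prop)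
  have hi : Integrable (fun ξ => if h + ξ ≤ t then inputFun A₁ φ ξ else 0) (atomMeasure h) :=
    (integrable_inputFun H.cont₁ φ).indicator hm
  rw [integral_atomMeasure H.nonneg (integrable_atomMeasure.1 hi)]
  congr 1
  · rw [if_pos (by linarith), inputFun_atom]
  · have e := intervalIntegral.integral_comp_sub_right
      (fun ξ => act (A₁ (h + ξ)) (histFun φ ξ)) (a := 0) (b := t) h
    simp only [add_sub_cancel, zero_sub] at e
    rw [e, intervalIntegral.integral_of_le (by linarith [H.nonneg]),
      intervalIntegral.integral_of_le (by linarith), ← integral_indicator measurableSet_Ioc,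
      ← integral_indicator measurableSet_Ioc]
    refine integral_congr_ae ?_
    have : ∀ᵐ x : ℝ, x ≠ 0 := by simp [ae_iff, measure_singleton]
    filter_upwards [this] with ξ hξ
    simp only [indicator_apply, histFun]
    by_cases h1 : ξ ∈ Ioc (-h) 0
    · have h2 : ξ ∈ Ioo (-h) 0 := ⟨h1.1, lt_of_le_of_ne h1.2 hξ⟩
      rw [if_pos h1, inputFun_of_mem A₁ φ h1, if_pos h2]
      by_cases h3 : h + ξ ≤ t
      · rw [if_pos h3, if_pos ⟨h1.1, by linarith⟩]
      · rw [if_neg h3, if_neg fun h4 => h3 (by linarith [h4.2])]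
    · rw [if_neg h1, if_neg (fun h2 => h1 (Ioo_subset_Ioc_self h2)), map_zero, ite_self]

/-- The right-hand side of the delay equation along `mildSol`. -/
def mildRhs (A₀ A₁ : ℝ → Mat n) (φ : State n h) (σ : ℝ) : Vec n :=
  act (A₀ σ) (mildSol A₀ A₁ φ σ) + act (A₁ σ) (mildSol A₀ A₁ φ (σ - h) + histFun φ (σ - h))

/-- Integrate the equation of `K(·, h + ξ)` against the input density and interchange the integrals;
the history term comes from `integral_inputFun_ite`. -/
theorem IsAdmissible.mildSol_eq_integral (H : IsAdmissible A₀ A₁ h T) (φ : State n h) {t : ℝ}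
    (ht : 0 ≤ t) :
    IntervalIntegrable (mildRhs A₀ A₁ φ) volume 0 t ∧
      mildSol A₀ A₁ φ t = φ.fst + ∫ σ in (0 : ℝ)..t, mildRhs A₀ A₁ φ σ := by
  set K := fundMatrix A₀ A₁ h with hK
  obtain ⟨C, hC0, hC⟩ := H.exists_norm_le t
  obtain ⟨M₀, hM₀0, hM₀⟩ := exists_norm_act_le H.pos H.cont₀ H.per₀
  obtain ⟨M₁, hM₁0, hM₁⟩ := exists_norm_act_le H.pos H.cont₁ H.per₁
  -- The integrand of `fundMatrix_eq_integral`, as a kernel in (start parameter `ξ`, time `σ`).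
  let N : ℝ × ℝ → Vec n →L[ℂ] Vec n := fun p =>
    act (A₀ p.2) * act (K p.2 (h + p.1)) + act (A₁ p.2) * act (K (p.2 - h) (h + p.1))
  have hNm : StronglyMeasurable N :=
    ((continuous_act.comp (H.cont₀.comp continuous_snd)).stronglyMeasurable.mul
      (H.stronglyMeasurable_act_fundMatrix (by fun_prop) (by fun_prop))).add
    ((continuous_act.comp (H.cont₁.comp continuous_snd)).stronglyMeasurable.mul
      (H.stronglyMeasurable_act_fundMatrix (by fun_prop) (by fun_prop)))
  have hNb : ∀ ξ ∈ Icc (-h) 0, ∀ σ ∈ Ioc 0 t, ‖N (ξ, σ)‖ ≤ M₀ * C + M₁ * C := by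
    intro ξ hξ σ hσ
    refine (norm_add_le _ _).trans (add_le_add ?_ ?_) <;> refine (norm_mul_le _ _).trans ?_
    · exact mul_le_mul (hM₀ _) (hC _ _ hσ.2 (by linarith [hξ.1])) (norm_nonneg _) hM₀0
    · exact mul_le_mul (hM₁ _) (hC _ _ (by linarith [hσ.2, H.nonneg]) (by linarith [hξ.1]))
        (norm_nonneg _) hM₁0
  have hae : ∀ᵐ p ∂((atomMeasure h).prod (volume.restrict (Ioc 0 t))),
      ‖N p‖ ≤ M₀ * C + M₁ * C := by
    have h1 := Measure.ae_prod_mem_iff_ae_ae_mem (μ := atomMeasure h)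
      (ν := volume.restrict (Ioc 0 t)) (s := {p | ‖N p‖ ≤ M₀ * C + M₁ * C})
      (measurableSet_le hNm.norm.measurable measurable_const)
    refine h1.2 ?_
    filter_upwards [ae_atomMeasure_mem_Icc H.nonneg] with ξ hξ
    filter_upwards [ae_restrict_mem measurableSet_Ioc] with σ hσ
    exact hNb ξ hξ σ hσ
  have hint := integrable_kernel_apply hNm.aestronglyMeasurable hae
    (integrable_inputFun H.cont₁ φ)
  have hinner : ∀ σ, ∫ ξ, N (ξ, σ) (inputFun A₁ φ ξ) ∂(atomMeasure h)
      = act (A₀ σ) (mildSol A₀ A₁ φ σ) + act (A₁ σ) (mildSol A₀ A₁ φ (σ - h)) := by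
    intro σ
    have i1 := H.integrable_fundMatrix_inputFun φ σ
    have i2 := H.integrable_fundMatrix_inputFun φ (σ - h)
    rw [mildSol, mildSol, ← ContinuousLinearMap.integral_comp_comm _ i1,
      ← ContinuousLinearMap.integral_comp_comm _ i2, ← integral_add
        ((act (A₀ σ)).integrable_comp i1) ((act (A₁ σ)).integrable_comp i2)]
    rfl
  have hswap : ∫ ξ, (∫ σ in (0 : ℝ)..t, N (ξ, σ) (inputFun A₁ φ ξ)) ∂(atomMeasure h)
      = ∫ σ in (0 : ℝ)..t, (act (A₀ σ) (mildSol A₀ A₁ φ σ)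
          + act (A₁ σ) (mildSol A₀ A₁ φ (σ - h))) := by
    simp only [intervalIntegral.integral_of_le ht]
    rw [integral_integral_swap (f := fun ξ σ => N (ξ, σ) (inputFun A₁ φ ξ)) hint]
    simp only [hinner]
  have hright := hint.integral_prod_right
  simp only [hinner] at hright
  have hright' : IntervalIntegrable (fun σ => act (A₀ σ) (mildSol A₀ A₁ φ σ)
      + act (A₁ σ) (mildSol A₀ A₁ φ (σ - h))) volume 0 t :=
    (intervalIntegrable_iff_integrableOn_Ioc_of_le ht).2 hright
  have hist := H.intervalIntegrable_act_histFun φ 0 t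
  have hrhs : mildRhs A₀ A₁ φ = fun σ => (act (A₀ σ) (mildSol A₀ A₁ φ σ)
      + act (A₁ σ) (mildSol A₀ A₁ φ (σ - h))) + act (A₁ σ) (histFun φ (σ - h)) := by
    ext1 σ; simp only [mildRhs, map_add]; abel
  refine ⟨hrhs ▸ hright'.add hist, ?_⟩
  rw [hrhs, intervalIntegral.integral_add hright' hist, ← hswap, add_comm (∫ ξ, _ ∂_), ← add_assoc,
    ← H.integral_inputFun_ite φ ht, mildSol, ← integral_add]
  · refine integral_congr_ae ?_
    filter_upwards [ae_atomMeasure_mem_Icc H.nonneg] with ξ hξ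
    have hiN : IntervalIntegrable (fun σ => N (ξ, σ)) volume 0 t := by
      rw [intervalIntegrable_iff_integrableOn_Ioc_of_le ht]
      refine Integrable.of_bound (hNm.comp_measurable
        measurable_prodMk_left).aestronglyMeasurable (M₀ * C + M₁ * C) ?_
      filter_upwards [ae_restrict_mem measurableSet_Ioc] with σ hσ
      exact hNb ξ hξ σ hσ
    rw [fundMatrix_eq_integral H.nonneg H.pos H.cont₀ H.per₀ H.cont₁ H.per₁
      (by linarith [hξ.1]) ht, add_apply,
      ← ContinuousLinearMap.intervalIntegral_apply hiN]
    split_ifs <;> rfl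
  · exact (integrable_inputFun H.cont₁ φ).indicator
      (measurableSet_le (f := fun ξ : ℝ => h + ξ) (by fun_prop) (measurable_const (a := t)))
  · simp only [intervalIntegral.integral_of_le ht]
    exact hint.integral_prod_left

end Mild

/-! ### Absolute continuity of vector-valued primitives. -/

section AbsCont

open AbsolutelyContinuousOnInterval

theorem absolutelyContinuousOnInterval_congr {X : Type*} [PseudoMetricSpace X] {f g : ℝ → X}
    {a b : ℝ} (hf : AbsolutelyContinuousOnInterval f a b) (hfg : EqOn f g (uIcc a b)) :
    AbsolutelyContinuousOnInterval g a b := by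
  refine Filter.Tendsto.congr' ?_ hf
  filter_upwards [Filter.mem_inf_of_right (Filter.mem_principal_self _)] with I hI
  refine Finset.sum_congr rfl fun i hi => ?_
  rw [hfg (hI.1 i hi).1, hfg (hI.1 i hi).2]

/-- Increments of the primitive of `g` are dominated by those of the real primitive of `‖g‖`. -/
theorem absolutelyContinuousOnInterval_integral {E : Type*} [NormedAddCommGroup E]
    [NormedSpace ℝ E] {g : ℝ → E} {a b : ℝ} (hg : IntervalIntegrable g volume a b) :
    AbsolutelyContinuousOnInterval (fun x => ∫ t in a..x, g t) a b := by
  have hn := hg.norm.absolutelyContinuousOnInterval_intervalIntegral (c := a) left_mem_uIcc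
  refine squeeze_zero' (.of_forall fun I => Finset.sum_nonneg fun _ _ => dist_nonneg) ?_ hn
  filter_upwards [Filter.mem_inf_of_right (Filter.mem_principal_self _)] with I hI
  refine Finset.sum_le_sum fun i hi => ?_
  have h1 := (hI.1 i hi).1
  have h2 := (hI.1 i hi).2
  have key : ∀ c ∈ uIcc a b, IntervalIntegrable g volume a c := fun c hc =>
    hg.mono_set (uIcc_subset_uIcc_left hc)
  rw [dist_eq_norm, dist_eq_norm, intervalIntegral.integral_interval_sub_left (key _ h1) (key _ h2),
    intervalIntegral.integral_interval_sub_left (key _ h1).norm (key _ h2).norm]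
  exact intervalIntegral.norm_integral_le_abs_integral_norm

end AbsCont

/-! ### Existence and uniqueness of solutions, and the evolution family. -/

section Solution

variable {n : ℕ} {A₀ A₁ : ℝ → Mat n} {h T : ℝ}

theorem ae_ne_real (a : ℝ) : ∀ᵐ x : ℝ, x ≠ a := by simp [ae_iff, measure_singleton]

theorem histFun_of_nonneg (φ : State n h) {t : ℝ} (ht : 0 ≤ t) : histFun φ t = 0 :=
  indicator_of_notMem (fun H => absurd H.2 (not_lt.2 ht)) _

theorem IsAdmissible.absolutelyContinuous_mildSol (H : IsAdmissible A₀ A₁ h T) (φ : State n h)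
    {b : ℝ} (hb : 0 ≤ b) : AbsolutelyContinuousOnInterval (mildSol A₀ A₁ φ) 0 b := by
  have h1 := absolutelyContinuousOnInterval_integral (H.mildSol_eq_integral φ hb).1
  have h2 : AbsolutelyContinuousOnInterval (fun _ : ℝ => φ.fst) 0 b :=
    ((LipschitzWith.const φ.fst).lipschitzOnWith (s := uIcc 0 b)).absolutelyContinuousOnInterval
  refine absolutelyContinuousOnInterval_congr (h2.add h1) fun t ht => ?_
  rw [uIcc_of_le hb] at ht
  exact (H.mildSol_eq_integral φ ht.1).2.symm

theorem continuousOn_Ici_of_absolutelyContinuous {X : Type*} [NormedAddCommGroup X] {f : ℝ → X}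
    (hf : ∀ b, 0 ≤ b → AbsolutelyContinuousOnInterval f 0 b) : ContinuousOn f (Ici 0) := by
  intro t ht
  have ht' : (0 : ℝ) ≤ t := ht
  have h0 : (0 : ℝ) ≤ t + 1 := by linarith
  have h1 : ContinuousOn f (uIcc 0 (t + 1)) := (hf (t + 1) h0).continuousOn
  have h2 : t ∈ uIcc 0 (t + 1) := by
    rw [uIcc_of_le h0]; exact ⟨ht', by linarith⟩
  have h3 : uIcc 0 (t + 1) ∈ nhdsWithin t (Ici 0) := by
    rw [uIcc_of_le h0, ← Ici_inter_Iic]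
    exact Filter.inter_mem self_mem_nhdsWithin
      (mem_nhdsWithin_of_mem_nhds (Iic_mem_nhds (by linarith)))
  exact (h1 t h2).mono_of_mem_nhdsWithin h3

theorem IsAdmissible.continuousOn_mildSol (H : IsAdmissible A₀ A₁ h T) (φ : State n h) :
    ContinuousOn (mildSol A₀ A₁ φ) (Ici 0) :=
  continuousOn_Ici_of_absolutelyContinuous fun _ hb => H.absolutelyContinuous_mildSol φ hb

theorem ae_hasDerivAt_integral_Ici {E : Type*} [NormedAddCommGroup E] [NormedSpace ℝ E]
    [CompleteSpace E] {g : ℝ → E} (hg : ∀ b, 0 ≤ b → IntervalIntegrable g volume 0 b) :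
    ∀ᵐ t : ℝ, 0 ≤ t → HasDerivAt (fun x => ∫ σ in (0 : ℝ)..x, g σ) (g t) t := by
  have h1 : ∀ N : ℕ, _ := fun N => (hg N N.cast_nonneg).ae_hasDerivAt_integral
  filter_upwards [ae_all_iff.2 h1] with t ht h0
  obtain ⟨N, hN⟩ := exists_nat_ge t
  refine ht N ?_ 0 left_mem_uIcc
  rw [uIcc_of_le N.cast_nonneg]
  exact ⟨h0, hN⟩

/-- `mildSol` vanishes before `0`, so `histFun` has to supply the history there. Its open interval
leaves the value at `0` to `mildSol`, hence to `φ.fst`. -/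
theorem IsAdmissible.isSolution_mildSol (H : IsAdmissible A₀ A₁ h T) (φ : State n h) :
    IsSolution A₀ A₁ h 0 φ (fun t => mildSol A₀ A₁ φ t + histFun φ t) where
  initial := by
    have := (H.mildSol_eq_integral φ le_rfl).2
    rw [histFun_of_nonneg φ le_rfl, add_zero, this, intervalIntegral.integral_same, add_zero]
  history := by
    rw [ae_histMeasure_iff, ae_restrict_iff' measurableSet_Ioc]
    filter_upwards [ae_ne_real 0] with ξ hξ hm
    have hlt : ξ < 0 := lt_of_le_of_ne hm.2 hξ
    rw [zero_add, H.mildSol_of_neg φ hlt, zero_add]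
    exact indicator_of_mem (s := Ioo (-h) 0) ⟨hm.1, hlt⟩ _
  absCont b hb := by
    refine absolutelyContinuousOnInterval_congr (H.absolutelyContinuous_mildSol φ hb) fun t ht => ?_
    rw [uIcc_of_le hb] at ht
    simp only [histFun_of_nonneg φ ht.1, add_zero]
  equation := by
    rw [ae_restrict_iff' measurableSet_Ici]
    filter_upwards [ae_hasDerivAt_integral_Ici fun b hb => (H.mildSol_eq_integral φ hb).1,
      ae_ne_real 0] with t ht hne h0
    have hpos : 0 < t := lt_of_le_of_ne h0 (Ne.symm hne)
    have e : act (A₀ t) (mildSol A₀ A₁ φ t + histFun φ t)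
        + act (A₁ t) (mildSol A₀ A₁ φ (t - h) + histFun φ (t - h)) = mildRhs A₀ A₁ φ t := by
      rw [histFun_of_nonneg φ h0, add_zero]; rfl
    rw [e]
    refine ((ht h0).const_add φ.fst).congr_of_eventuallyEq ?_
    filter_upwards [Ioi_mem_nhds hpos] with r hr
    rw [histFun_of_nonneg φ (le_of_lt hr), add_zero, (H.mildSol_eq_integral φ (le_of_lt hr)).2]

/-- The difference, cut off before `0`, solves the homogeneous equation almost everywhere; absolute
continuity upgrades this to an integral equation, and Gronwall applies. -/
theorem IsAdmissible.isSolution_unique (H : IsAdmissible A₀ A₁ h T) {φ : State n h}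
    {x y : ℝ → Vec n} (hx : IsSolution A₀ A₁ h 0 φ x) (hy : IsSolution A₀ A₁ h 0 φ y)
    {t : ℝ} (ht : 0 ≤ t) : x t = y t := by
  obtain ⟨M₀, hM₀0, hM₀⟩ := exists_norm_act_le H.pos H.cont₀ H.per₀
  obtain ⟨M₁, hM₁0, hM₁⟩ := exists_norm_act_le H.pos H.cont₁ H.per₁
  set d : ℝ → Vec n := (Ici (0 : ℝ)).indicator (fun r => x r - y r) with hd
  have hdpos : ∀ r, 0 ≤ r → d r = x r - y r := fun r hr => indicator_of_mem (s := Ici 0) hr _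
  have hdneg : ∀ r, r < 0 → d r = 0 := fun r hr =>
    indicator_of_notMem (s := Ici 0) (by simpa using hr) _
  have hdAC : ∀ b, 0 ≤ b → AbsolutelyContinuousOnInterval d 0 b := fun b hb =>
    absolutelyContinuousOnInterval_congr ((hx.absCont b hb).sub (hy.absCont b hb)) fun r hr => by
      rw [uIcc_of_le hb] at hr
      rw [hdpos r hr.1]; rfl
  have hdc := continuousOn_Ici_of_absolutelyContinuous hdAC
  have i1 : ∀ a b, IntervalIntegrable (fun σ => act (A₀ σ) (d σ)) volume a b :=
    intervalIntegrable_of_eq_zero_before (s := 0) (fun r hr => by rw [hdneg r hr, map_zero])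
      ((continuous_act.comp H.cont₀).continuousOn.clm_apply hdc)
  have i2 : ∀ a b, IntervalIntegrable (fun σ => act (A₁ σ) (d (σ - h))) volume a b := by
    refine intervalIntegrable_of_eq_zero_before (s := h)
      (fun r hr => by rw [hdneg _ (by linarith), map_zero]) ?_
    refine (continuous_act.comp H.cont₁).continuousOn.clm_apply (hdc.comp (by fun_prop) ?_)
    intro r hr
    simp only [mem_Ici] at hr ⊢; linarith
  have hg : ∀ a b, IntervalIntegrable (fun σ => act (A₀ σ) (d σ) + act (A₁ σ) (d (σ - h)))
      volume a b := fun a b => (i1 a b).add (i2 a b)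
  -- The histories agree only almost everywhere, which makes the cut-off harmless in the delayed
  -- term for almost every time.
  have hhist : ∀ᵐ r : ℝ, r - h ∈ Icc (-h) 0 → x (r - h) = y (r - h) := by
    have h1 : ∀ᵐ ξ : ℝ, ξ ∈ Icc (-h) 0 → x ξ = y ξ := by
      filter_upwards [(ae_restrict_iff' measurableSet_Icc).1 hx.history,
        (ae_restrict_iff' measurableSet_Icc).1 hy.history] with ξ h1 h2 hm
      have h3 := (h1 hm).trans (h2 hm).symm
      rwa [zero_add] at h3
    exact (measurePreserving_sub_right volume h).quasiMeasurePreserving.ae h1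
  have hderiv : ∀ᵐ r : ℝ, 0 ≤ r →
      HasDerivAt d (act (A₀ r) (d r) + act (A₁ r) (d (r - h))) r := by
    have e1 := (ae_restrict_iff' measurableSet_Ici).1 hx.equation
    have e2 := (ae_restrict_iff' measurableSet_Ici).1 hy.equation
    filter_upwards [e1, e2, hhist, ae_ne_real 0] with r h1 h2 h3 hne h0
    have hpos : 0 < r := lt_of_le_of_ne h0 (Ne.symm hne)
    have e3 : d (r - h) = x (r - h) - y (r - h) := by
      rcases lt_or_ge (r - h) 0 with hlt | hge
      · rw [hdneg _ hlt, h3 ⟨by linarith, hlt.le⟩, sub_self]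
      · exact hdpos _ hge
    rw [hdpos r h0, e3, map_sub, map_sub]
    have h4 := (h1 h0).sub (h2 h0)
    rw [add_sub_add_comm] at h4
    refine h4.congr_of_eventuallyEq ?_
    filter_upwards [Ioi_mem_nhds hpos] with q hq
    exact hdpos q (le_of_lt hq)
  have hd0 : d 0 = 0 := by
    rw [hdpos 0 le_rfl, hx.initial, hy.initial, sub_self]
  have hint : ∀ b, 0 ≤ b →
      d b = ∫ σ in (0 : ℝ)..b, (act (A₀ σ) (d σ) + act (A₁ σ) (d (σ - h))) := by
    intro b hb
    -- `d` minus the primitive of its derivative is absolutely continuous with zero derivative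
    -- almost everywhere, hence constant.
    obtain ⟨c, hc⟩ := ((hdAC b hb).sub (absolutelyContinuousOnInterval_integral
      (hg 0 b))).const_of_ae_hasDerivAt_zero (by
        filter_upwards [hderiv, ae_hasDerivAt_integral_Ici fun b _ => hg 0 b] with r h1 h2 hr
        rw [uIcc_of_le hb] at hr
        simpa using (h1 hr.1).sub (h2 hr.1))
    have c0 := hc 0 left_mem_uIcc
    have cb := hc b right_mem_uIcc
    simp only [Pi.sub_apply, intervalIntegral.integral_same, hd0, sub_zero] at c0 cb
    rw [← c0, sub_eq_zero] at cb
    exact cb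
  have key := eq_zero_of_delay_integral_bound (d := d) (t₀ := 0) (b := t) (M := M₀ + M₁) H.nonneg
    (by positivity) hdneg (hdc.mono Icc_subset_Ici_self) (fun c hc => ?_) t ⟨ht, le_rfl⟩
  · rw [hdpos t ht, sub_eq_zero] at key
    exact key
  · have g1 := intervalIntegrable_of_eq_zero_before hdneg hdc
    have g2 := (g1 (0 - h) (c - h)).comp_sub_right h
    simp only [sub_add_cancel] at g2
    rw [hint c hc.1]
    refine intervalIntegral.norm_integral_le_of_norm_le hc.1 (.of_forall fun σ _ => ?_)
      (((g1 0 c).norm.add g2.norm).const_mul _)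
    rw [mul_add]
    refine (norm_add_le _ _).trans (add_le_add ?_ ?_)
    · exact (act (A₀ σ)).le_of_opNorm_le ((hM₀ σ).trans (by linarith)) _
    · exact (act (A₁ σ)).le_of_opNorm_le ((hM₁ σ).trans (by linarith)) _

theorem IsAdmissible.aestronglyMeasurable_mildSol (H : IsAdmissible A₀ A₁ h T) (φ : State n h) :
    AEStronglyMeasurable (mildSol A₀ A₁ φ) volume := by
  have e : mildSol A₀ A₁ φ = (Ici (0 : ℝ)).indicator (mildSol A₀ A₁ φ) := by
    refine (indicator_eq_self.2 fun t ht => ?_).symm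
    by_contra hneg
    exact ht (H.mildSol_of_neg φ (not_le.1 hneg))
  rw [e, aestronglyMeasurable_indicator_iff measurableSet_Ici]
  exact (H.continuousOn_mildSol φ).aestronglyMeasurable measurableSet_Ici

theorem IsAdmissible.exists_norm_mildSol_le (H : IsAdmissible A₀ A₁ h T) (φ : State n h) (b : ℝ) :
    ∃ C, ∀ t, t ≤ b → ‖mildSol A₀ A₁ φ t‖ ≤ C := by
  obtain ⟨C, hC⟩ := (isCompact_Icc (a := (0 : ℝ)) (b := b)).exists_bound_of_continuousOn
    ((H.continuousOn_mildSol φ).mono Icc_subset_Ici_self)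
  refine ⟨max C 0, fun t ht => ?_⟩
  rcases lt_or_ge t 0 with hneg | hpos
  · rw [H.mildSol_of_neg φ hneg, norm_zero]; exact le_max_right _ _
  · exact (hC t ⟨hpos, ht⟩).trans (le_max_left _ _)

/-- Ensures that the predicate in the choice defining `evolution` is satisfiable, by square
integrability of each translated history. -/
theorem IsAdmissible.exists_isStateAt (H : IsAdmissible A₀ A₁ h T) (φ : State n h) (t : ℝ) :
    ∃ z : State n h, IsStateAt (fun r => mildSol A₀ A₁ φ r + histFun φ r) t z := by
  have m1 : MemLp (fun θ => mildSol A₀ A₁ φ (t + θ)) 2 (histMeasure h) := by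
    obtain ⟨C, hC⟩ := H.exists_norm_mildSol_le φ t
    refine MemLp.of_bound ?_ C ?_
    · exact ((H.aestronglyMeasurable_mildSol φ).comp_quasiMeasurePreserving
        (measurePreserving_add_left volume t).quasiMeasurePreserving).restrict
    · filter_upwards [ae_restrict_mem measurableSet_Icc] with θ hθ
      exact hC _ (by linarith [hθ.2])
  have m2 : MemLp (fun θ => histFun φ (t + θ)) 2 (histMeasure h) := by
    have h1 : MemLp (histFun φ) 2 volume := by
      unfold histFun
      rw [memLp_indicator_iff_restrict measurableSet_Ioo]
      exact (Lp.memLp φ.snd).mono_measure (Measure.restrict_mono Ioo_subset_Icc_self le_rfl)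
    exact (h1.comp_measurePreserving (measurePreserving_add_left volume t)).restrict _
  refine ⟨WithLp.toLp 2 (mildSol A₀ A₁ φ t + histFun φ t, (m1.add m2).toLp _), rfl, ?_⟩
  exact (m1.add m2).coeFn_toLp

/-- The evolution family is given by the variation of constants formula. -/
theorem IsAdmissible.evolution_fst (H : IsAdmissible A₀ A₁ h T) (φ : State n h) {t : ℝ}
    (ht : 0 ≤ t) : (evolution A₀ A₁ h t 0 φ).fst = mildSol A₀ A₁ φ t := by
  obtain ⟨z, hz⟩ := H.exists_isStateAt φ t
  obtain ⟨x, hx, hxz⟩ := Classical.epsilon_spec (p := fun z : State n h =>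
    ∃ x, IsSolution A₀ A₁ h 0 φ x ∧ IsStateAt x t z) ⟨z, _, H.isSolution_mildSol φ, hz⟩
  have e := H.isSolution_unique hx (H.isSolution_mildSol φ) ht
  rw [histFun_of_nonneg φ ht, add_zero] at e
  exact hxz.1.trans e

/-- For `t ≥ h` the window `[t - h, t]` lies in `[0, ∞)`, so the initial history no longer appears.
At `t = T` this is where `h ≤ T` enters. -/
theorem IsAdmissible.evolution_snd (H : IsAdmissible A₀ A₁ h T) (φ : State n h) {t : ℝ}
    (ht : h ≤ t) : ∀ᵐ θ ∂(histMeasure h),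
      (evolution A₀ A₁ h t 0 φ).snd θ = mildSol A₀ A₁ φ (t + θ) := by
  obtain ⟨z, hz⟩ := H.exists_isStateAt φ t
  obtain ⟨x, hx, hxz⟩ := Classical.epsilon_spec (p := fun z : State n h =>
    ∃ x, IsSolution A₀ A₁ h 0 φ x ∧ IsStateAt x t z) ⟨z, _, H.isSolution_mildSol φ, hz⟩
  filter_upwards [hxz.2, ae_restrict_mem measurableSet_Icc] with θ h1 hθ
  have h0 : 0 ≤ t + θ := by linarith [hθ.1]
  have e := H.isSolution_unique hx (H.isSolution_mildSol φ) h0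
  rw [histFun_of_nonneg φ h0, add_zero] at e
  exact h1.trans e

end Solution

/-! ### Fubini identities for operator kernels. -/

section Swap

variable {α Ω V : Type*} [MeasurableSpace α] [MeasurableSpace Ω]
  [NormedAddCommGroup V] [InnerProductSpace ℂ V] [CompleteSpace V]
  {μ : Measure α} {ρ : Measure Ω} [IsFiniteMeasure μ] [IsFiniteMeasure ρ]

/-- The measures are finite and the kernels bounded, so the integrability of `f` alone gives
integrability on the product. -/
theorem integral_clm_integral_swap {L : Ω → V →L[ℂ] V} {N : α × Ω → V →L[ℂ] V} {f : α → V}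
    {C₁ C₂ : ℝ} (hL : AEStronglyMeasurable L ρ) (hLb : ∀ᵐ ω ∂ρ, ‖L ω‖ ≤ C₁)
    (hN : AEStronglyMeasurable N (μ.prod ρ)) (hNb : ∀ᵐ p ∂(μ.prod ρ), ‖N p‖ ≤ C₂)
    (hf : Integrable f μ) :
    Integrable (fun s => (∫ ω, L ω * N (s, ω) ∂ρ) (f s)) μ ∧
      ∫ ω, L ω (∫ s, N (s, ω) (f s) ∂μ) ∂ρ = ∫ s, (∫ ω, L ω * N (s, ω) ∂ρ) (f s) ∂μ := by
  have hMm : AEStronglyMeasurable (fun p : α × Ω => L p.2 * N p) (μ.prod ρ) :=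
    (hL.comp_quasiMeasurePreserving Measure.quasiMeasurePreserving_snd).mul hN
  have hMb : ∀ᵐ p ∂(μ.prod ρ), ‖L p.2 * N p‖ ≤ C₁ * C₂ := by
    filter_upwards [hNb, Measure.quasiMeasurePreserving_snd.ae hLb] with p h1 h2
    exact (norm_mul_le _ _).trans
      (mul_le_mul h2 h1 (norm_nonneg _) ((norm_nonneg _).trans h2))
  have hMi : Integrable (fun p : α × Ω => L p.2 * N p) (μ.prod ρ) := .of_bound hMm _ hMb
  have h1 := integrable_kernel_apply hMm hMb hf
  have h2 := integrable_kernel_apply hN hNb hf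
  have h3 : (fun s => ∫ ω, (L ω * N (s, ω)) (f s) ∂ρ) =ᵐ[μ]
      fun s => (∫ ω, L ω * N (s, ω) ∂ρ) (f s) := by
    filter_upwards [hMi.prod_right_ae] with s hs
    exact (ContinuousLinearMap.integral_apply hs (f s)).symm
  refine ⟨h1.integral_prod_left.congr h3, ?_⟩
  calc ∫ ω, L ω (∫ s, N (s, ω) (f s) ∂μ) ∂ρ
      = ∫ ω, (∫ s, (L ω * N (s, ω)) (f s) ∂μ) ∂ρ := by
        refine integral_congr_ae ?_
        filter_upwards [h2.prod_left_ae] with ω hω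
        exact ((L ω).integral_comp_comm hω).symm
    _ = ∫ s, (∫ ω, (L ω * N (s, ω)) (f s) ∂ρ) ∂μ :=
        (integral_integral_swap (f := fun s ω => (L ω * N (s, ω)) (f s)) h1).symm
    _ = _ := integral_congr_ae h3

theorem integral_inner_integral_swap {N : α × Ω → V →L[ℂ] V} {f : α → V} {v : Ω → V}
    {C : ℝ} (hN : AEStronglyMeasurable N (μ.prod ρ)) (hNb : ∀ᵐ p ∂(μ.prod ρ), ‖N p‖ ≤ C)
    (hf : Integrable f μ) (hv : Integrable v ρ) :
    Integrable
        (fun θ => inner ℂ (f θ) (∫ ω, ContinuousLinearMap.adjoint (N (θ, ω)) (v ω) ∂ρ)) μ ∧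
      ∫ ω, inner ℂ (∫ θ, N (θ, ω) (f θ) ∂μ) (v ω) ∂ρ
        = ∫ θ, inner ℂ (f θ) (∫ ω, ContinuousLinearMap.adjoint (N (θ, ω)) (v ω) ∂ρ) ∂μ := by
  have hAm : AEStronglyMeasurable (fun p => ContinuousLinearMap.adjoint (N p)) (μ.prod ρ) :=
    ContinuousLinearMap.adjoint.continuous.comp_aestronglyMeasurable hN
  have hAb : ∀ᵐ p ∂(μ.prod ρ), ‖ContinuousLinearMap.adjoint (N p)‖ ≤ C := by
    filter_upwards [hNb] with p hp
    rwa [LinearIsometryEquiv.norm_map]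
  have h1 := integrable_kernel_apply hN hNb hf
  have h2 := integrable_clm_apply hAm hAb (hv.comp_snd μ)
  have h3 : Integrable (fun p : α × Ω => inner ℂ (N p (f p.1)) (v p.2)) (μ.prod ρ) := by
    refine ((hf.norm.mul_prod hv.norm).const_mul C).mono'
      (h1.aestronglyMeasurable.inner (hv.comp_snd μ).aestronglyMeasurable) ?_
    filter_upwards [hNb] with p hp
    refine (norm_inner_le_norm _ _).trans ?_
    rw [← mul_assoc]
    exact mul_le_mul_of_nonneg_right ((N p).le_of_opNorm_le hp _) (norm_nonneg _)
  have left : ∀ {g : α → V} (w : V), Integrable g μ →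
      inner ℂ (∫ θ, g θ ∂μ) w = ∫ θ, inner ℂ (g θ) w ∂μ := by
    intro g w hg
    rw [← inner_conj_symm, ← integral_inner hg w, ← integral_conj]
    simp only [inner_conj_symm]
  have h4 : (fun θ => ∫ ω, inner ℂ (N (θ, ω) (f θ)) (v ω) ∂ρ) =ᵐ[μ]
      fun θ => inner ℂ (f θ) (∫ ω, ContinuousLinearMap.adjoint (N (θ, ω)) (v ω) ∂ρ) := by
    filter_upwards [h2.prod_right_ae] with θ hθ
    rw [← integral_inner hθ]
    simp only [ContinuousLinearMap.adjoint_inner_right]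
  refine ⟨h3.integral_prod_left.congr h4, ?_⟩
  calc ∫ ω, inner ℂ (∫ θ, N (θ, ω) (f θ) ∂μ) (v ω) ∂ρ
      = ∫ ω, (∫ θ, inner ℂ (N (θ, ω) (f θ)) (v ω) ∂μ) ∂ρ := by
        refine integral_congr_ae ?_
        filter_upwards [h1.prod_left_ae] with ω hω
        exact left _ hω
    _ = ∫ θ, (∫ ω, inner ℂ (N (θ, ω) (f θ)) (v ω) ∂ρ) ∂μ :=
        (integral_integral_swap (f := fun θ ω => inner ℂ (N (θ, ω) (f θ)) (v ω)) h3).symm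
    _ = _ := integral_congr_ae h4

/-- The common form of both terms of the equation for `U₀`: with `Ω` the pairs `(p, q)` and `B`
built from `U` it yields the `𝓛` term, with `Ω` the time interval and `B` built from `W` the
inhomogeneity. -/
theorem integral_inner_sandwich {N₁ N₂ : α × Ω → V →L[ℂ] V} {B : Ω → V →L[ℂ] V} {f : α → V}
    {C₁ C₂ D : ℝ} (hN₁ : AEStronglyMeasurable N₁ (μ.prod ρ))
    (hN₁b : ∀ᵐ p ∂(μ.prod ρ), ‖N₁ p‖ ≤ C₁)
    (hN₂ : AEStronglyMeasurable N₂ (μ.prod ρ)) (hN₂b : ∀ᵐ p ∂(μ.prod ρ), ‖N₂ p‖ ≤ C₂)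
    (hB : AEStronglyMeasurable B ρ) (hBb : ∀ᵐ ω ∂ρ, ‖B ω‖ ≤ D) (hf : Integrable f μ) :
    (∀ᵐ θ ∂μ, Integrable (fun s =>
        (∫ ω, ContinuousLinearMap.adjoint (N₁ (θ, ω)) * B ω * N₂ (s, ω) ∂ρ) (f s)) μ) ∧
      Integrable (fun θ => inner ℂ (f θ) (∫ s,
        (∫ ω, ContinuousLinearMap.adjoint (N₁ (θ, ω)) * B ω * N₂ (s, ω) ∂ρ) (f s) ∂μ)) μ ∧
      ∫ θ, inner ℂ (f θ) (∫ s,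
        (∫ ω, ContinuousLinearMap.adjoint (N₁ (θ, ω)) * B ω * N₂ (s, ω) ∂ρ) (f s) ∂μ) ∂μ
      = ∫ ω, inner ℂ (∫ θ, N₁ (θ, ω) (f θ) ∂μ) (B ω (∫ s, N₂ (s, ω) (f s) ∂μ)) ∂ρ := by
  have hA : ∀ᵐ θ ∂μ, Integrable (fun s =>
        (∫ ω, ContinuousLinearMap.adjoint (N₁ (θ, ω)) * B ω * N₂ (s, ω) ∂ρ) (f s)) μ ∧
      ∫ ω, ContinuousLinearMap.adjoint (N₁ (θ, ω)) (B ω (∫ s, N₂ (s, ω) (f s) ∂μ)) ∂ρ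
        = ∫ s, (∫ ω, ContinuousLinearMap.adjoint (N₁ (θ, ω)) * B ω * N₂ (s, ω) ∂ρ) (f s) ∂μ := by
    filter_upwards [hN₁.prodMk_left, Measure.ae_ae_of_ae_prod hN₁b] with θ h1 h2
    refine integral_clm_integral_swap (C₁ := C₁ * D)
      (L := fun ω => ContinuousLinearMap.adjoint (N₁ (θ, ω)) * B ω)
      ((ContinuousLinearMap.adjoint.continuous.comp_aestronglyMeasurable h1).mul hB) ?_
      hN₂ hN₂b hf
    filter_upwards [h2, hBb] with ω h3 h4
    refine (norm_mul_le _ _).trans (mul_le_mul ?_ h4 (norm_nonneg _) ((norm_nonneg _).trans h3))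
    rwa [LinearIsometryEquiv.norm_map]
  have hv : Integrable (fun ω => B ω (∫ s, N₂ (s, ω) (f s) ∂μ)) ρ :=
    integrable_clm_apply hB hBb (integrable_kernel_apply hN₂ hN₂b hf).integral_prod_right
  obtain ⟨i, e⟩ := integral_inner_integral_swap hN₁ hN₁b hf hv
  have hc : (fun θ => inner ℂ (f θ) (∫ ω, ContinuousLinearMap.adjoint (N₁ (θ, ω))
      (B ω (∫ s, N₂ (s, ω) (f s) ∂μ)) ∂ρ)) =ᵐ[μ] fun θ => inner ℂ (f θ) (∫ s,
        (∫ ω, ContinuousLinearMap.adjoint (N₁ (θ, ω)) * B ω * N₂ (s, ω) ∂ρ) (f s) ∂μ) := by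
    filter_upwards [hA] with θ hθ
    rw [hθ.2]
  exact ⟨hA.mono fun _ hθ => hθ.1, i.congr hc, by rw [e]; exact (integral_congr_ae hc).symm⟩

end Swap

/-! ### The Lyapunov operator and its quadratic form. -/

section Operator

variable {n : ℕ} {h : ℝ} {A₁ : ℝ → Mat n}

theorem inputFun_add (A₁ : ℝ → Mat n) (φ ψ : State n h) :
    ∀ᵐ ξ ∂(atomMeasure h), inputFun A₁ (φ + ψ) ξ = inputFun A₁ φ ξ + inputFun A₁ ψ ξ := by
  refine ae_atomMeasure.2 ⟨by simp only [inputFun_atom]; rfl, ?_⟩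
  filter_upwards [ae_restrict_mem measurableSet_Ioc,
    ae_histMeasure_iff.1 (Lp.coeFn_add φ.snd ψ.snd)] with ξ hξ h1
  rw [inputFun_of_mem A₁ _ hξ, inputFun_of_mem A₁ _ hξ, inputFun_of_mem A₁ _ hξ, ← map_add]
  exact congrArg _ h1

theorem inputFun_smul (A₁ : ℝ → Mat n) (c : ℂ) (φ : State n h) :
    ∀ᵐ ξ ∂(atomMeasure h), inputFun A₁ (c • φ) ξ = c • inputFun A₁ φ ξ := by
  refine ae_atomMeasure.2 ⟨by simp only [inputFun_atom]; rfl, ?_⟩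
  filter_upwards [ae_restrict_mem measurableSet_Ioc,
    ae_histMeasure_iff.1 (Lp.coeFn_smul c φ.snd)] with ξ hξ h1
  rw [inputFun_of_mem A₁ _ hξ, inputFun_of_mem A₁ _ hξ, ← map_smul]
  exact congrArg _ h1

/-- Hölder's inequality on a finite measure space: `L²` embeds in `L¹`. -/
theorem exists_integral_norm_snd_le (n : ℕ) (h : ℝ) :
    ∃ C : ℝ, 0 ≤ C ∧ ∀ Φ : Hist n h, ∫ ξ in Ioc (-h) 0, ‖Φ ξ‖ ≤ C * ‖Φ‖ := by
  have htop : (histMeasure h) univ ^ ((1 : ℝ) - 1 / 2) ≠ ⊤ :=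
    ENNReal.rpow_ne_top_of_nonneg (by norm_num) (measure_ne_top _ _)
  refine ⟨((histMeasure h) univ ^ ((1 : ℝ) - 1 / 2)).toReal, ENNReal.toReal_nonneg, fun Φ => ?_⟩
  have h1 := eLpNorm_le_eLpNorm_mul_rpow_measure_univ (p := 1) (q := 2) one_le_two
    (Lp.memLp Φ).aestronglyMeasurable
  have h2 := ENNReal.toReal_mono (ENNReal.mul_ne_top (Lp.memLp Φ).eLpNorm_ne_top htop)
    (by simpa using h1)
  rw [ENNReal.toReal_mul, eLpNorm_one_eq_lintegral_enorm,
    ← integral_norm_eq_lintegral_enorm (Lp.memLp Φ).aestronglyMeasurable, ← Lp.norm_def,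
    mul_comm] at h2
  rw [restrict_Ioc_eq_restrict_Icc]
  exact h2

/-- The source of the boundedness of the operator: its rows depend on `φ` only through the `L¹` norm
of the density. -/
theorem exists_integral_norm_inputFun_le (hh : 0 ≤ h) (hA₁ : Continuous A₁) :
    ∃ C : ℝ, 0 ≤ C ∧ ∀ φ : State n h, ∫ ξ, ‖inputFun A₁ φ ξ‖ ∂(atomMeasure h) ≤ C * ‖φ‖ := by
  obtain ⟨C, hC0, hC⟩ := exists_integral_norm_snd_le n h
  obtain ⟨M, hM⟩ := (isCompact_Icc (a := (-h)) (b := 0)).exists_bound_of_continuousOn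
    (f := fun ξ => act (A₁ (h + ξ))) (continuous_act.comp (by fun_prop)).continuousOn
  have hM0 : 0 ≤ M := (norm_nonneg _).trans (hM 0 ⟨by linarith, le_rfl⟩)
  refine ⟨1 + M * C, by positivity, fun φ => ?_⟩
  have hi := (integrable_inputFun hA₁ φ).norm
  rw [integral_atomMeasure hh (integrable_atomMeasure.1 hi), inputFun_atom,
    intervalIntegral.integral_of_le (by linarith)]
  have h1 : ∫ ξ in Ioc (-h) 0, ‖inputFun A₁ φ ξ‖ ≤ ∫ ξ in Ioc (-h) 0, M * ‖φ.snd ξ‖ := by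
    refine setIntegral_mono_on (integrable_atomMeasure.1 hi)
      ((integrableOn_snd φ).norm.const_mul M) measurableSet_Ioc fun ξ hξ => ?_
    rw [inputFun_of_mem A₁ φ hξ]
    exact (act _).le_of_opNorm_le (hM ξ (Ioc_subset_Icc_self hξ)) _
  rw [integral_const_mul] at h1
  have h2 := hC φ.snd
  have h3 : ‖φ.fst‖ ≤ ‖φ‖ := WithLp.norm_fst_le _ φ
  have h4 : ‖φ.snd‖ ≤ ‖φ‖ := WithLp.norm_snd_le _ φ
  have h5 : M * ∫ ξ in Ioc (-h) 0, ‖φ.snd ξ‖ ≤ M * (C * ‖φ‖) := by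
    gcongr; exact h2.trans (by gcongr)
  nlinarith

/-- The rows `φ ↦ U(r, 0) φ₀ + ∫ U(r, h + θ) A₁(h + θ) Φ(θ) dθ` of the Lyapunov operator. -/
def rowFun (A₁ : ℝ → Mat n) (U : ℝ → ℝ → Mat n) (r : ℝ) (φ : State n h) : Vec n :=
  ∫ ξ, act (U r (h + ξ)) (inputFun A₁ φ ξ) ∂(atomMeasure h)

variable {U : ℝ → ℝ → Mat n} {C : ℝ}

theorem integrable_rowFun (hA₁ : Continuous A₁) (hU : Continuous fun p : ℝ × ℝ => U p.1 p.2)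
    (hC : ∀ r s, ‖act (U r s)‖ ≤ C) (r : ℝ) (φ : State n h) :
    Integrable (fun ξ => act (U r (h + ξ)) (inputFun A₁ φ ξ)) (atomMeasure h) := by
  refine integrable_clm_apply (C := C) ?_ (.of_forall fun ξ => hC _ _) (integrable_inputFun hA₁ φ)
  exact (continuous_act.comp (hU.comp (f := fun ξ => (r, h + ξ))
    (by fun_prop))).aestronglyMeasurable

theorem norm_rowFun_le (hA₁ : Continuous A₁) (hC : ∀ r s, ‖act (U r s)‖ ≤ C) (r : ℝ)
    (φ : State n h) :
    ‖rowFun A₁ U r φ‖ ≤ C * ∫ ξ, ‖inputFun A₁ φ ξ‖ ∂(atomMeasure h) := by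
  rw [← integral_const_mul]
  exact norm_integral_le_of_norm_le ((integrable_inputFun hA₁ φ).norm.const_mul C)
    (.of_forall fun ξ => (act _).le_of_opNorm_le (hC _ _) _)

theorem continuous_rowFun (hA₁ : Continuous A₁) (hU : Continuous fun p : ℝ × ℝ => U p.1 p.2)
    (hC : ∀ r s, ‖act (U r s)‖ ≤ C) (φ : State n h) : Continuous fun r => rowFun A₁ U r φ := by
  refine continuous_of_dominated
    (fun r => (integrable_rowFun hA₁ hU hC r φ).aestronglyMeasurable)
    (fun r => .of_forall fun ξ => (act _).le_of_opNorm_le (hC _ _) _)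
    ((integrable_inputFun hA₁ φ).norm.const_mul C) (.of_forall fun ξ => ?_)
  exact (continuous_act.comp (hU.comp (f := fun r => (r, h + ξ)) (by fun_prop))).clm_apply
    continuous_const

theorem rowFun_add (hA₁ : Continuous A₁) (hU : Continuous fun p : ℝ × ℝ => U p.1 p.2)
    (hC : ∀ r s, ‖act (U r s)‖ ≤ C) (r : ℝ) (φ ψ : State n h) :
    rowFun A₁ U r (φ + ψ) = rowFun A₁ U r φ + rowFun A₁ U r ψ := by
  rw [rowFun, rowFun, rowFun, ← integral_add (integrable_rowFun hA₁ hU hC r φ)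
    (integrable_rowFun hA₁ hU hC r ψ)]
  refine integral_congr_ae ?_
  filter_upwards [inputFun_add A₁ φ ψ] with ξ hξ
  rw [hξ, map_add]

theorem rowFun_smul (r : ℝ) (c : ℂ) (φ : State n h) :
    rowFun A₁ U r (c • φ) = c • rowFun A₁ U r φ := by
  rw [rowFun, rowFun, ← integral_smul]
  refine integral_congr_ae ?_
  filter_upwards [inputFun_smul A₁ c φ] with ξ hξ
  rw [hξ, map_smul]

theorem rowFun_eq (hh : 0 ≤ h) (hA₁ : Continuous A₁)
    (hU : Continuous fun p : ℝ × ℝ => U p.1 p.2) (hC : ∀ r s, ‖act (U r s)‖ ≤ C) (r : ℝ)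
    (φ : State n h) : rowFun A₁ U r φ = act (U r 0) φ.fst
      + ∫ θ in (-h)..0, act (U r (h + θ) * A₁ (h + θ)) (φ.snd θ) := by
  rw [rowFun, integral_atomMeasure hh
    (integrable_atomMeasure.1 (integrable_rowFun hA₁ hU hC r φ)), inputFun_atom, add_neg_cancel]
  congr 1
  rw [intervalIntegral.integral_of_le (by linarith), intervalIntegral.integral_of_le (by linarith)]
  refine setIntegral_congr_fun measurableSet_Ioc fun ξ hξ => ?_
  simp only [inputFun_of_mem A₁ φ hξ, act_mul_apply]

/-- The second component of the Lyapunov operator. -/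
def colFun (A₁ : ℝ → Mat n) (U : ℝ → ℝ → Mat n) (φ : State n h) (θ : ℝ) : Vec n :=
  act (A₁ (h + θ)).transpose (rowFun A₁ U (h + θ) φ)

theorem memLp_colFun (hA₁ : Continuous A₁) (hU : Continuous fun p : ℝ × ℝ => U p.1 p.2)
    (hC : ∀ r s, ‖act (U r s)‖ ≤ C) (φ : State n h) :
    MemLp (colFun A₁ U φ) 2 (histMeasure h) := by
  have hc : Continuous (colFun A₁ U φ) :=
    (continuous_act.comp (by fun_prop)).clm_apply
      ((continuous_rowFun hA₁ hU hC φ).comp (by fun_prop))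
  obtain ⟨B, hB⟩ := (isCompact_Icc (a := (-h)) (b := 0)).exists_bound_of_continuousOn
    hc.continuousOn
  exact MemLp.of_bound hc.aestronglyMeasurable B
    ((ae_restrict_mem measurableSet_Icc).mono fun θ hθ => hB θ hθ)

theorem exists_lyapunovOperator (hh : 0 ≤ h) (hA₁ : Continuous A₁)
    (hU : Continuous fun p : ℝ × ℝ => U p.1 p.2) (hC : ∀ r s, ‖act (U r s)‖ ≤ C) :
    ∃ P : State n h →L[ℂ] State n h, ∀ φ, (P φ).fst = rowFun A₁ U 0 φ ∧
      ∀ᵐ θ ∂(histMeasure h), (P φ).snd θ = colFun A₁ U φ θ := by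
  obtain ⟨D, hD0, hD⟩ := exists_integral_norm_inputFun_le hh hA₁
  obtain ⟨M, hM⟩ := (isCompact_Icc (a := (-h)) (b := 0)).exists_bound_of_continuousOn
    (f := fun ξ => act (A₁ (h + ξ)).transpose) (continuous_act.comp (by fun_prop)).continuousOn
  have hM0 : 0 ≤ M := (norm_nonneg _).trans (hM 0 ⟨by linarith, le_rfl⟩)
  have hC0 : 0 ≤ C := (norm_nonneg _).trans (hC 0 0)
  have hrow : ∀ r (φ : State n h), ‖rowFun A₁ U r φ‖ ≤ C * D * ‖φ‖ := fun r φ =>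
    (norm_rowFun_le hA₁ hC r φ).trans (by rw [mul_assoc]; gcongr; exact hD φ)
  let col : State n h → Hist n h := fun φ => (memLp_colFun hA₁ hU hC φ).toLp _
  have hcol : ∀ φ, ∀ᵐ θ ∂(histMeasure h), col φ θ = colFun A₁ U φ θ := fun φ =>
    (memLp_colFun hA₁ hU hC φ).coeFn_toLp
  -- An `L²` norm is at most the square root of the total mass times a uniform bound; here that
  -- bound is `M * (C * D) * ‖φ‖`.
  let B : ℝ := measureUnivNNReal (histMeasure h) ^ (2 : ENNReal).toReal⁻¹ * (M * (C * D))
  have hcolb : ∀ φ, ‖col φ‖ ≤ B * ‖φ‖ := fun φ => by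
    have := Lp.norm_le_of_ae_bound (f := col φ) (C := M * (C * D * ‖φ‖)) (by positivity) (by
      filter_upwards [hcol φ, ae_restrict_mem measurableSet_Icc] with θ h1 hθ
      rw [h1]
      refine ((act _).le_of_opNorm_le (hM θ hθ) _).trans ?_
      gcongr
      exact hrow _ _)
    refine this.trans (le_of_eq ?_)
    simp only [B]; ring
  let P₁ : State n h →ₗ[ℂ] Vec n :=
    { toFun := rowFun A₁ U 0
      map_add' := rowFun_add hA₁ hU hC 0
      map_smul' := rowFun_smul 0 }
  let P₂ : State n h →ₗ[ℂ] Hist n h :=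
    { toFun := col
      map_add' := fun φ ψ => by
        refine Lp.ext ?_
        filter_upwards [hcol φ, hcol ψ, hcol (φ + ψ), Lp.coeFn_add (col φ) (col ψ)]
          with θ h1 h2 h3 h4
        rw [h4, Pi.add_apply, h1, h2, h3]
        simp only [colFun, rowFun_add hA₁ hU hC, map_add]
      map_smul' := fun c φ => by
        refine Lp.ext ?_
        filter_upwards [hcol φ, hcol (c • φ), Lp.coeFn_smul c (col φ)] with θ h1 h3 h4
        rw [RingHom.id_apply, h4, Pi.smul_apply, h1, h3]
        simp only [colFun, rowFun_smul, map_smul] }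
  refine ⟨((WithLp.prodContinuousLinearEquiv 2 ℂ (Vec n) (Hist n h)).symm :
      (Vec n × Hist n h) →L[ℂ] State n h) ∘L
    ((P₁.mkContinuous (C * D) (hrow 0)).prod (P₂.mkContinuous B hcolb)), fun φ => ⟨rfl, hcol φ⟩⟩

/-- Moving `A₁ᵀ` to the other side turns `Φ` into the density `A₁ Φ`; the finite-dimensional
component is the contribution of the atom. -/
theorem inner_lyapunovOperator (hh : 0 ≤ h) (hA₁ : Continuous A₁)
    (hU : Continuous fun p : ℝ × ℝ => U p.1 p.2) (hC : ∀ r s, ‖act (U r s)‖ ≤ C)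
    {φ z : State n h} (hz₁ : z.fst = rowFun A₁ U 0 φ)
    (hz₂ : ∀ᵐ θ ∂(histMeasure h), z.snd θ = colFun A₁ U φ θ) :
    inner ℂ φ z = ∫ ξ, inner ℂ (inputFun A₁ φ ξ) (rowFun A₁ U (h + ξ) φ) ∂(atomMeasure h) := by
  have hc := (continuous_rowFun hA₁ hU hC φ).comp (g := fun r => rowFun A₁ U r φ)
    (f := fun ξ => h + ξ) (by fun_prop)
  have hi : Integrable (fun ξ => inner ℂ (inputFun A₁ φ ξ) (rowFun A₁ U (h + ξ) φ))
      (atomMeasure h) := by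
    refine ((integrable_inputFun hA₁ φ).norm.mul_const
      (C * ∫ ξ, ‖inputFun A₁ φ ξ‖ ∂(atomMeasure h))).mono'
      ((integrable_inputFun hA₁ φ).aestronglyMeasurable.inner hc.aestronglyMeasurable)
      (.of_forall fun ξ => (norm_inner_le_norm _ _).trans ?_)
    gcongr
    exact norm_rowFun_le hA₁ hC _ φ
  rw [integral_atomMeasure hh (integrable_atomMeasure.1 hi), inputFun_atom, add_neg_cancel,
    intervalIntegral.integral_of_le (by linarith), WithLp.prod_inner_apply]
  congr 1
  · exact congrArg _ hz₁
  · rw [L2.inner_def, restrict_Ioc_eq_restrict_Icc]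
    have e : ∀ᵐ θ ∂(histMeasure h), θ ∈ Ioc (-h) 0 :=
      ae_histMeasure_iff.2 (ae_restrict_mem measurableSet_Ioc)
    refine integral_congr_ae ?_
    filter_upwards [hz₂, e] with θ h1 h2
    rw [inputFun_of_mem A₁ φ h2, ← inner_act_transpose]
    exact congrArg _ h1

end Operator

/-! ### Entrywise integrals as operator integrals, and extension of `U₀`. -/

section MatrixIntegrals

variable {n : ℕ}

theorem act_entry (A : Mat n) (i j : Fin n) :
    A i j = (act A (EuclideanSpace.single j (1 : ℂ)) i).re := by
  simp [act_apply]

theorem intervalIntegrable_entry {a b : ℝ} {F : ℝ → Mat n}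
    (hF : IntervalIntegrable (fun t => act (F t)) volume a b) (i j : Fin n) :
    IntervalIntegrable (fun t => F t i j) volume a b := by
  let ℓ : (Vec n →L[ℂ] Vec n) →L[ℝ] ℝ := Complex.reCLM ∘L
    (((EuclideanSpace.proj i : Vec n →L[ℂ] ℂ) ∘L
      ContinuousLinearMap.apply ℂ (Vec n) (EuclideanSpace.single j (1 : ℂ))).restrictScalars ℝ)
  have e : (fun t => F t i j) = fun t => ℓ (act (F t)) := funext fun t => act_entry (F t) i j
  rw [e]
  exact ⟨ℓ.integrable_comp hF.1, ℓ.integrable_comp hF.2⟩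

/-- Agreement on the half-open interval is enough, which matters because the kernels take their atom
value at the left end `-h`. -/
theorem act_matIntegral_eq {a b : ℝ} (hab : a ≤ b) {F : ℝ → Mat n} {g : ℝ → Vec n →L[ℂ] Vec n}
    (hg : IntervalIntegrable g volume a b) (hF : ∀ t ∈ Ioc a b, act (F t) = g t) :
    act (matIntegral a b F) = ∫ t in a..b, g t := by
  have e : EqOn g (fun t => act (F t)) (uIoc a b) := fun t ht => by
    rw [uIoc_of_le hab] at ht; exact (hF t ht).symm
  rw [act_matIntegral (intervalIntegrable_entry (hg.congr e))]
  refine intervalIntegral.integral_congr_ae (.of_forall fun t ht => (e ht).symm)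

theorem act_mul_matIntegral {a b : ℝ} (hab : a ≤ b) (A : Mat n) {F : ℝ → Mat n}
    {g : ℝ → Vec n →L[ℂ] Vec n}
    (hg : IntervalIntegrable g volume a b) (hF : ∀ t ∈ Ioc a b, act (F t) = g t) :
    act (A * matIntegral a b F) = ∫ t in a..b, act A * g t := by
  rw [act_mul, act_matIntegral_eq hab hg hF]
  exact ((ContinuousLinearMap.mul ℂ (Vec n →L[ℂ] Vec n) (act A)).intervalIntegral_comp_comm
    hg).symm

theorem act_matIntegral_mul {a b : ℝ} (hab : a ≤ b) (A : Mat n) {F : ℝ → Mat n}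
    {g : ℝ → Vec n →L[ℂ] Vec n}
    (hg : IntervalIntegrable g volume a b) (hF : ∀ t ∈ Ioc a b, act (F t) = g t) :
    act (matIntegral a b F * A) = ∫ t in a..b, g t * act A := by
  rw [act_mul, act_matIntegral_eq hab hg hF]
  exact (((ContinuousLinearMap.mul ℂ (Vec n →L[ℂ] Vec n)).flip (act A)).intervalIntegral_comp_comm
    hg).symm

theorem matIntegral_congr {a b : ℝ} (hab : a ≤ b) {F G : ℝ → Mat n}
    (hFG : ∀ t ∈ Icc a b, F t = G t) : matIntegral a b F = matIntegral a b G := by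
  ext i j
  refine intervalIntegral.integral_congr fun t ht => ?_
  rw [uIcc_of_le hab] at ht
  simp only [hFG t ht]

theorem opL_congr {A₁ : ℝ → Mat n} {h T : ℝ} (hh : 0 ≤ h) (K : ℝ → ℝ → Mat n)
    {U U' : ℝ → ℝ → Mat n} (hU : ∀ θ ∈ Icc 0 h, ∀ s ∈ Icc 0 h, U θ s = U' θ s) (θ s : ℝ) :
    opL A₁ h T K U θ s = opL A₁ h T K U' θ s := by
  have h0 : (0 : ℝ) ∈ Icc 0 h := ⟨le_rfl, hh⟩
  have hl : ∀ {ξ : ℝ}, ξ ∈ Icc (-h) 0 → h + ξ ∈ Icc 0 h := fun hξ =>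
    ⟨by linarith [hξ.1], by linarith [hξ.2]⟩
  have hr : ∀ {ξ : ℝ}, ξ ∈ Icc (-h) 0 → ξ + h ∈ Icc 0 h := fun hξ =>
    ⟨by linarith [hξ.1], by linarith [hξ.2]⟩
  have hle : -h ≤ 0 := by linarith
  unfold opL
  rw [hU 0 h0 0 h0]
  congr 1
  · congr 1
    · congr 2
      exact matIntegral_congr hle fun ξ hξ => by rw [hU 0 h0 _ (hl hξ)]
    · congr 1
      exact matIntegral_congr hle fun ξ hξ => by rw [hU _ (hr hξ) 0 h0]
  · exact matIntegral_congr hle fun ξ hξ => matIntegral_congr hle fun η hη => by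
      rw [hU _ (hl hξ) _ (hl hη)]

/-- A continuous function on a square extends to a bounded continuous function on the plane. -/
theorem exists_continuous_extension {h : ℝ} (hh : 0 ≤ h) {U₀ : ℝ → ℝ → Mat n}
    (hU₀ : ContinuousOn (fun p : ℝ × ℝ => U₀ p.1 p.2) (Icc 0 h ×ˢ Icc 0 h)) :
    ∃ U : ℝ → ℝ → Mat n, Continuous (fun p : ℝ × ℝ => U p.1 p.2) ∧
      (∀ θ ∈ Icc 0 h, ∀ s ∈ Icc 0 h, U₀ θ s = U θ s) ∧ ∃ C, ∀ r s, ‖act (U r s)‖ ≤ C := by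
  -- Clamping both arguments to `[0, h]` preserves continuity and the bound attained on the square.
  let q : ℝ → ℝ := fun r => (projIcc 0 h hh r : ℝ)
  have hq : Continuous q := continuous_subtype_val.comp continuous_projIcc
  have hqm : ∀ r, q r ∈ Icc 0 h := fun r => (projIcc 0 h hh r).2
  have hqe : ∀ r ∈ Icc 0 h, q r = r := fun r hr => by simp only [q, projIcc_of_mem hh hr]
  obtain ⟨C, hC⟩ := (isCompact_Icc.prod isCompact_Icc).exists_bound_of_continuousOn
    (continuous_act.comp_continuousOn hU₀)
  refine ⟨fun r s => U₀ (q r) (q s), ?_, fun θ hθ s hs => ?_, C, fun r s => ?_⟩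
  · exact hU₀.comp_continuous (f := fun p : ℝ × ℝ => (q p.1, q p.2)) (by fun_prop)
      fun p => ⟨hqm _, hqm _⟩
  · simp only [hqe θ hθ, hqe s hs]
  · exact hC (q r, q s) ⟨hqm r, hqm s⟩

end MatrixIntegrals

/-! ### Integration against the square of `atomMeasure`. -/

section DoubleIntegral

variable {E : Type*} [NormedAddCommGroup E]

theorem integrable_atomMeasure_of_bound {h : ℝ} (hh : 0 ≤ h) {g : ℝ → E} {C : ℝ}
    (hg : StronglyMeasurable g) (hC : ∀ r ∈ Icc (-h) 0, ‖g r‖ ≤ C) :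
    Integrable g (atomMeasure h) :=
  .of_bound hg.aestronglyMeasurable C ((ae_atomMeasure_mem_Icc hh).mono hC)

theorem ae_prod_atomMeasure_mem {h : ℝ} (hh : 0 ≤ h) :
    ∀ᵐ p ∂((atomMeasure h).prod (atomMeasure h)), p.1 ∈ Icc (-h) 0 ∧ p.2 ∈ Icc (-h) 0 :=
  (Measure.quasiMeasurePreserving_fst.ae (ae_atomMeasure_mem_Icc hh)).and
    (Measure.quasiMeasurePreserving_snd.ae (ae_atomMeasure_mem_Icc hh))

theorem intervalIntegrable_of_integrable_atomMeasure {h : ℝ} (hh : 0 ≤ h) {g : ℝ → E}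
    (hg : Integrable g (atomMeasure h)) : IntervalIntegrable g volume (-h) 0 :=
  (intervalIntegrable_iff_integrableOn_Ioc_of_le (by linarith)).2 (integrable_atomMeasure.1 hg)

theorem integrable_prod_atomMeasure_of_bound {h : ℝ} (hh : 0 ≤ h) {G : ℝ × ℝ → E} {C : ℝ}
    (hG : StronglyMeasurable G)
    (hC : ∀ r ∈ Icc (-h) 0, ∀ s ∈ Icc (-h) 0, ‖G (r, s)‖ ≤ C) :
    Integrable G ((atomMeasure h).prod (atomMeasure h)) :=
  .of_bound hG.aestronglyMeasurable C
    ((ae_prod_atomMeasure_mem hh).mono fun p hp => hC p.1 hp.1 p.2 hp.2)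

variable [NormedSpace ℝ E]

theorem intervalIntegrable_integral_of_bound {h : ℝ} (hh : 0 ≤ h) {G : ℝ × ℝ → E} {C : ℝ}
    (hG : StronglyMeasurable G)
    (hC : ∀ r ∈ Icc (-h) 0, ∀ s ∈ Icc (-h) 0, ‖G (r, s)‖ ≤ C) :
    IntervalIntegrable (fun r => ∫ s in (-h)..0, G (r, s)) volume (-h) 0 := by
  have hi : Integrable G ((atomMeasure h).prod (volume.restrict (Ioc (-h) 0))) := by
    refine .of_bound hG.aestronglyMeasurable C ?_
    filter_upwards [Measure.quasiMeasurePreserving_fst.ae (ae_atomMeasure_mem_Icc hh),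
      Measure.quasiMeasurePreserving_snd.ae (ae_restrict_mem measurableSet_Ioc)] with p h1 h2
    exact hC p.1 h1 p.2 (Ioc_subset_Icc_self h2)
  simp only [intervalIntegral.integral_of_le (show -h ≤ 0 by linarith)]
  exact intervalIntegrable_of_integrable_atomMeasure hh hi.integral_prod_left

/-- Point mass or density in each of the two variables gives four pieces, which become the four
terms of `𝓛`. -/
theorem integral_prod_atomMeasure [CompleteSpace E] {h : ℝ} (hh : 0 ≤ h) {G : ℝ × ℝ → E} {C : ℝ}
    (hG : StronglyMeasurable G)
    (hC : ∀ r ∈ Icc (-h) 0, ∀ s ∈ Icc (-h) 0, ‖G (r, s)‖ ≤ C) :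
    ∫ p, G p ∂((atomMeasure h).prod (atomMeasure h))
      = G (-h, -h) + (∫ s in (-h)..0, G (-h, s)) + (∫ r in (-h)..0, G (r, -h))
        + ∫ r in (-h)..0, ∫ s in (-h)..0, G (r, s) := by
  have hle : -h ≤ 0 := by linarith
  have hm : -h ∈ Icc (-h) 0 := ⟨le_rfl, hle⟩
  have hi := integrable_prod_atomMeasure_of_bound hh hG hC
  have hrow : ∀ r ∈ Icc (-h) 0, ∫ s, G (r, s) ∂(atomMeasure h)
      = G (r, -h) + ∫ s in (-h)..0, G (r, s) := fun r hr =>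
    integral_atomMeasure hh (integrable_atomMeasure.1 (integrable_atomMeasure_of_bound hh
      (hG.comp_measurable measurable_prodMk_left) (hC r hr)))
  have h1 : IntervalIntegrable (fun r => G (r, -h)) volume (-h) 0 :=
    intervalIntegrable_of_integrable_atomMeasure hh (integrable_atomMeasure_of_bound hh
      (hG.comp_measurable measurable_prodMk_right) fun r hr => hC r hr _ hm)
  rw [integral_prod _ hi, integral_atomMeasure hh (integrable_atomMeasure.1 hi.integral_prod_left),
    hrow _ hm]
  have h2 : ∫ r in (-h)..0, (∫ s, G (r, s) ∂(atomMeasure h))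
      = ∫ r in (-h)..0, (G (r, -h) + ∫ s in (-h)..0, G (r, s)) :=
    intervalIntegral.integral_congr fun r hr => hrow r (by rwa [uIcc_of_le hle] at hr)
  rw [h2, intervalIntegral.integral_add h1 (intervalIntegrable_integral_of_bound hh hG hC)]
  abel

end DoubleIntegral

/-! ### `𝓛` and the inhomogeneity as kernel integrals. -/

section Kernels

variable {n : ℕ} {A₀ A₁ : ℝ → Mat n} {h T : ℝ}

/-- The kernel that maps the data of the initial state to the data of the state at the time `T`. -/
def monodromyKernel (A₀ A₁ : ℝ → Mat n) (h T r s : ℝ) : Mat n :=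
  if r = -h then fundMatrix A₀ A₁ h T (h + s)
  else A₁ (h + r) * fundMatrix A₀ A₁ h (T + r) (h + s)

theorem IsAdmissible.stronglyMeasurable_monodromyKernel (H : IsAdmissible A₀ A₁ h T) {γ : Type*}
    [MeasurableSpace γ] {u v : γ → ℝ} (hu : Measurable u) (hv : Measurable v) :
    StronglyMeasurable fun c => act (monodromyKernel A₀ A₁ h T (u c) (v c)) := by
  have e : (fun c => act (monodromyKernel A₀ A₁ h T (u c) (v c))) = fun c =>
      if u c = -h then act (fundMatrix A₀ A₁ h T (h + v c))
      else act (A₁ (h + u c)) * act (fundMatrix A₀ A₁ h (T + u c) (h + v c)) := by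
    ext1 c
    unfold monodromyKernel
    split_ifs
    · rfl
    · rw [act_mul]
  rw [e]
  refine StronglyMeasurable.ite (hu (measurableSet_singleton (-h)))
    (H.stronglyMeasurable_act_fundMatrix (by fun_prop) (by fun_prop)) ?_
  refine StronglyMeasurable.mul ?_ (H.stronglyMeasurable_act_fundMatrix (by fun_prop) (by fun_prop))
  exact (continuous_act.comp H.cont₁).stronglyMeasurable.comp_measurable
    (g := fun c => h + u c) (by fun_prop)

theorem IsAdmissible.exists_norm_monodromyKernel_le (H : IsAdmissible A₀ A₁ h T) :
    ∃ C, 0 ≤ C ∧ ∀ r ∈ Icc (-h) 0, ∀ s ∈ Icc (-h) 0,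
      ‖act (monodromyKernel A₀ A₁ h T r s)‖ ≤ C := by
  obtain ⟨C, hC0, hC⟩ := H.exists_norm_le T
  obtain ⟨M, hM0, hM⟩ := exists_norm_act_le H.pos H.cont₁ H.per₁
  refine ⟨max C (M * C), le_max_of_le_left hC0, fun r hr s hs => ?_⟩
  unfold monodromyKernel
  split_ifs
  · exact (hC _ _ le_rfl (by linarith [hs.1])).trans (le_max_left _ _)
  · rw [act_mul]
    refine (norm_mul_le _ _).trans (le_max_of_le_right ?_)
    exact mul_le_mul (hM _) (hC _ _ (by linarith [hr.2]) (by linarith [hs.1])) (norm_nonneg _) hM0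

theorem monodromyKernel_atom (A₀ A₁ : ℝ → Mat n) (h T s : ℝ) :
    monodromyKernel A₀ A₁ h T (-h) s = fundMatrix A₀ A₁ h T (h + s) := if_pos rfl

theorem monodromyKernel_of_mem (A₀ A₁ : ℝ → Mat n) (h T s : ℝ) {r : ℝ} (hr : r ∈ Ioc (-h) 0) :
    monodromyKernel A₀ A₁ h T r s = A₁ (h + r) * fundMatrix A₀ A₁ h (T + r) (h + s) :=
  if_neg hr.1.ne'

/-- Variation of constants in both cases: at time `T` on the atom, and at time `T + r`, multiplied
by `A₁ (h + r)`, elsewhere. -/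
theorem IsAdmissible.integral_monodromyKernel (H : IsAdmissible A₀ A₁ h T) (hhT : h ≤ T)
    (φ : State n h) : ∀ᵐ r ∂(atomMeasure h),
      ∫ s, act (monodromyKernel A₀ A₁ h T r s) (inputFun A₁ φ s) ∂(atomMeasure h)
        = inputFun A₁ (monodromy A₀ A₁ h T φ) r := by
  refine ae_atomMeasure.2 ⟨?_, ?_⟩
  · simp only [monodromyKernel_atom, inputFun_atom]
    exact (H.evolution_fst φ H.pos.le).symm
  · filter_upwards [ae_restrict_mem measurableSet_Ioc,
      ae_histMeasure_iff.1 (H.evolution_snd φ hhT)] with r hr h1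
    rw [inputFun_of_mem A₁ _ hr]
    simp only [monodromyKernel_of_mem A₀ A₁ h T _ hr, act_mul_apply]
    rw [ContinuousLinearMap.integral_comp_comm _ (H.integrable_fundMatrix_inputFun φ (T + r))]
    exact congrArg _ h1.symm

/-- The kernel is `K(T, ·)` at the atom and `A₁ K` elsewhere, so splitting the double integral
reproduces the definition of `𝓛` term by term. -/
theorem IsAdmissible.act_opL (H : IsAdmissible A₀ A₁ h T) {U : ℝ → ℝ → Mat n} {D : ℝ}
    (hU : Continuous fun p : ℝ × ℝ => U p.1 p.2) (hD : ∀ r s, ‖act (U r s)‖ ≤ D)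
    {ξ η : ℝ} (hξ : ξ ∈ Icc (-h) 0) (hη : η ∈ Icc (-h) 0) :
    act (opL A₁ h T (fundMatrix A₀ A₁ h) U (h + ξ) (h + η))
      = ∫ p, ContinuousLinearMap.adjoint (act (monodromyKernel A₀ A₁ h T p.1 ξ))
          * act (U (h + p.1) (h + p.2)) * act (monodromyKernel A₀ A₁ h T p.2 η)
          ∂((atomMeasure h).prod (atomMeasure h)) := by
  have hh := H.nonneg
  have hle : -h ≤ 0 := by linarith
  have hm : -h ∈ Icc (-h) 0 := ⟨le_rfl, hle⟩
  obtain ⟨C, hC0, hC⟩ := H.exists_norm_monodromyKernel_le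
  set N := monodromyKernel A₀ A₁ h T with hN
  set K := fundMatrix A₀ A₁ h with hK
  have hD0 : 0 ≤ D := (norm_nonneg _).trans (hD 0 0)
  have mU : ∀ {γ : Type} [MeasurableSpace γ] {u v : γ → ℝ}, Measurable u → Measurable v →
      StronglyMeasurable fun c => act (U (u c) (v c)) := by
    intro γ _ u v hu hv
    exact (continuous_act.comp hU).stronglyMeasurable.comp_measurable (g := fun c => (u c, v c))
      (hu.prodMk hv)
  have mN : ∀ {γ : Type} [MeasurableSpace γ] {u : γ → ℝ} (s : ℝ), Measurable u →
      StronglyMeasurable fun c => act (N (u c) s) := fun s hu =>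
    H.stronglyMeasurable_monodromyKernel hu measurable_const
  have mNa : ∀ {γ : Type} [MeasurableSpace γ] {u : γ → ℝ} (s : ℝ), Measurable u →
      StronglyMeasurable fun c => ContinuousLinearMap.adjoint (act (N (u c) s)) := fun s hu =>
    ContinuousLinearMap.adjoint.continuous.comp_stronglyMeasurable (mN s hu)
  have bNa : ∀ r ∈ Icc (-h) 0, ‖ContinuousLinearMap.adjoint (act (N r ξ))‖ ≤ C := fun r hr => by
    rw [LinearIsometryEquiv.norm_map]; exact hC r hr ξ hξ
  have bl : ∀ r ∈ Icc (-h) 0, ∀ q s,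
      ‖ContinuousLinearMap.adjoint (act (N r ξ)) * act (U q s)‖ ≤ C * D := fun r hr q s =>
    (norm_mul_le _ _).trans (mul_le_mul (bNa r hr) (hD q s) (norm_nonneg _) hC0)
  have br : ∀ r ∈ Icc (-h) 0, ∀ q s, ‖act (U q s) * act (N r η)‖ ≤ D * C := fun r hr q s =>
    (norm_mul_le _ _).trans (mul_le_mul (hD q s) (hC r hr η hη) (norm_nonneg _) hD0)
  let G : ℝ × ℝ → Vec n →L[ℂ] Vec n := fun p =>
    ContinuousLinearMap.adjoint (act (N p.1 ξ)) * act (U (h + p.1) (h + p.2)) * act (N p.2 η)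
  have mG : StronglyMeasurable G :=
    ((mNa ξ measurable_fst).mul (mU (by fun_prop) (by fun_prop))).mul (mN η measurable_snd)
  have bG : ∀ r ∈ Icc (-h) 0, ∀ s ∈ Icc (-h) 0, ‖G (r, s)‖ ≤ C * D * C := fun r hr s hs =>
    (norm_mul_le _ _).trans (mul_le_mul (bl r hr _ _) (hC s hs η hη) (norm_nonneg _)
      (by positivity))
  have i2 : IntervalIntegrable (fun r => act (U 0 (h + r)) * act (N r η)) volume (-h) 0 :=
    intervalIntegrable_of_integrable_atomMeasure hh (integrable_atomMeasure_of_bound hh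
      ((mU measurable_const (by fun_prop)).mul (mN η measurable_id)) fun r hr => br r hr _ _)
  have i3 : IntervalIntegrable
      (fun r => ContinuousLinearMap.adjoint (act (N r ξ)) * act (U (h + r) 0)) volume (-h) 0 :=
    intervalIntegrable_of_integrable_atomMeasure hh (integrable_atomMeasure_of_bound hh
      ((mNa ξ measurable_id).mul (mU (by fun_prop) measurable_const)) fun r hr => bl r hr _ _)
  have i4 := intervalIntegrable_integral_of_bound hh mG bG
  have i4' : ∀ r ∈ Icc (-h) 0, IntervalIntegrable (fun s => G (r, s)) volume (-h) 0 := fun r hr =>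
    intervalIntegrable_of_integrable_atomMeasure hh (integrable_atomMeasure_of_bound hh
      (mG.comp_measurable measurable_prodMk_left) (bG r hr))
  have eN : ∀ r ∈ Ioc (-h) 0, N r η = A₁ (h + r) * K (T + r) (h + η) := fun r hr =>
    monodromyKernel_of_mem A₀ A₁ h T η hr
  have eNa : ∀ r ∈ Ioc (-h) 0, ContinuousLinearMap.adjoint (act (N r ξ))
      = act ((K (T + r) (h + ξ)).transpose * (A₁ (h + r)).transpose) := fun r hr => by
    rw [← act_transpose, hN, monodromyKernel_of_mem A₀ A₁ h T ξ hr, Matrix.transpose_mul]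
  have eN0 : N (-h) η = K T (h + η) := monodromyKernel_atom A₀ A₁ h T η
  have eNa0 : ContinuousLinearMap.adjoint (act (N (-h) ξ)) = act (K T (h + ξ)).transpose := by
    rw [← act_transpose, hN, monodromyKernel_atom]
  have t2 := act_mul_matIntegral hle (K T (h + ξ)).transpose
    (F := fun r => U 0 (h + r) * A₁ (h + r) * K (T + r) (h + η)) i2
    fun r hr => by rw [eN r hr, mul_assoc, act_mul]
  have t3 := act_matIntegral_mul hle (K T (h + η))
    (F := fun r => (K (T + r) (h + ξ)).transpose * (A₁ (h + r)).transpose * U (r + h) 0) i3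
    fun r hr => by rw [eNa r hr, act_mul _ (U _ _), add_comm r h]
  have t4 := act_matIntegral_eq hle (F := fun r => matIntegral (-h) 0 fun s =>
      (K (T + r) (h + ξ)).transpose * (A₁ (h + r)).transpose * U (h + r) (h + s)
        * A₁ (h + s) * K (T + s) (h + η)) i4
    fun r hr => act_matIntegral_eq hle (i4' r (Ioc_subset_Icc_self hr)) fun s hs => by
      simp only [G]
      rw [eNa r hr, eN s hs, ← act_mul, ← act_mul]
      simp only [mul_assoc]
  have main := integral_prod_atomMeasure hh mG bG
  change _ = ∫ p, G p ∂_
  rw [main, opL, act_add, act_add, act_add, t2, t3, t4]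
  simp only [G, eN0, eNa0, add_neg_cancel, act_mul, mul_assoc]

theorem IsAdmissible.act_inhom (H : IsAdmissible A₀ A₁ h T) {W : ℝ → Mat n} (hW : Continuous W)
    {θ s : ℝ} (hθ : 0 ≤ θ) (hs : 0 ≤ s) :
    act (inhom W T (fundMatrix A₀ A₁ h) θ s)
      = ∫ ω in Ioc 0 T, ContinuousLinearMap.adjoint (act (fundMatrix A₀ A₁ h ω θ))
          * act (W ω) * act (fundMatrix A₀ A₁ h ω s) := by
  obtain ⟨C, hC0, hC⟩ := H.exists_norm_le T
  obtain ⟨M, hM⟩ := (isCompact_Icc (a := (0 : ℝ)) (b := T)).exists_bound_of_continuousOn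
    (continuous_act.comp hW).continuousOn
  rw [← intervalIntegral.integral_of_le H.pos.le, inhom]
  refine act_matIntegral_eq H.pos.le ?_ fun ω _ => by rw [act_mul, act_mul, act_transpose]
  rw [intervalIntegrable_iff_integrableOn_Ioc_of_le H.pos.le]
  refine Integrable.of_bound (C := C * M * C) (StronglyMeasurable.mul (StronglyMeasurable.mul
    (ContinuousLinearMap.adjoint.continuous.comp_stronglyMeasurable
      (H.stronglyMeasurable_act_fundMatrix measurable_id measurable_const))
    (continuous_act.comp hW).stronglyMeasurable)
    (H.stronglyMeasurable_act_fundMatrix measurable_id measurable_const)).aestronglyMeasurable ?_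
  filter_upwards [ae_restrict_mem measurableSet_Ioc] with ω hω
  have hM' := hM ω (Ioc_subset_Icc_self hω)
  have hM0 : 0 ≤ M := (norm_nonneg _).trans hM'
  refine (norm_mul_le _ _).trans (mul_le_mul ((norm_mul_le _ _).trans (mul_le_mul ?_ hM'
    (norm_nonneg _) hC0)) (hC ω s hω.2 hs) (norm_nonneg _) (by positivity))
  rw [LinearIsometryEquiv.norm_map]
  exact hC ω θ hω.2 hθ

end Kernels

/-! ### The Lyapunov identity. -/

section Lyapunov

variable {n : ℕ} {A₀ A₁ : ℝ → Mat n} {h T : ℝ}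

theorem inner_weightOp (W : ℝ → Mat n) (t : ℝ) (z : State n h) :
    inner ℂ z (weightOp h W t z) = inner ℂ z.fst (act (W t) z.fst) := by
  rw [weightOp_apply, WithLp.prod_inner_apply]
  simp

theorem IsAdmissible.intervalIntegrable_inner_weightOp (H : IsAdmissible A₀ A₁ h T)
    {W : ℝ → Mat n} (hW : Continuous W) (φ : State n h) :
    IntervalIntegrable (fun ξ => inner ℂ (evolution A₀ A₁ h ξ 0 φ)
      (weightOp h W ξ (evolution A₀ A₁ h ξ 0 φ))) volume 0 T := by
  have hx := (H.continuousOn_mildSol φ).mono (show Icc 0 T ⊆ Ici 0 from Icc_subset_Ici_self)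
  have hc : ContinuousOn (fun ξ => inner ℂ (mildSol A₀ A₁ φ ξ)
      (act (W ξ) (mildSol A₀ A₁ φ ξ))) (Icc 0 T) :=
    hx.inner ((continuous_act.comp hW).continuousOn.clm_apply hx)
  refine ContinuousOn.intervalIntegrable ?_
  rw [uIcc_of_le H.pos.le]
  refine hc.congr fun ξ hξ => ?_
  rw [inner_weightOp, H.evolution_fst φ hξ.1]

/-- The quadratic form of the Lyapunov operator splits according to the integral equation. -/
theorem IsAdmissible.integral_rowFun_eq (H : IsAdmissible A₀ A₁ h T) (hhT : h ≤ T)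
    {W : ℝ → Mat n} (hW : Continuous W) {U : ℝ → ℝ → Mat n} {D : ℝ}
    (hU : Continuous fun p : ℝ × ℝ => U p.1 p.2) (hD : ∀ r s, ‖act (U r s)‖ ≤ D)
    (hUeq : ∀ θ ∈ Icc 0 h, ∀ s ∈ Icc 0 h,
      U θ s = opL A₁ h T (fundMatrix A₀ A₁ h) U θ s + inhom W T (fundMatrix A₀ A₁ h) θ s)
    (φ : State n h) :
    ∫ ξ, inner ℂ (inputFun A₁ φ ξ) (rowFun A₁ U (h + ξ) φ) ∂(atomMeasure h)
      = (∫ ξ, inner ℂ (inputFun A₁ (monodromy A₀ A₁ h T φ) ξ)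
          (rowFun A₁ U (h + ξ) (monodromy A₀ A₁ h T φ)) ∂(atomMeasure h))
        + ∫ ω in Ioc 0 T, inner ℂ (mildSol A₀ A₁ φ ω) (act (W ω) (mildSol A₀ A₁ φ ω)) := by
  have hh := H.nonneg
  set μ := atomMeasure h with hμ
  set N := monodromyKernel A₀ A₁ h T with hN
  set K := fundMatrix A₀ A₁ h with hK
  set f := inputFun A₁ φ with hf
  set z := inputFun A₁ (monodromy A₀ A₁ h T φ) with hz
  have hfi : Integrable f μ := integrable_inputFun H.cont₁ φ
  have hzi : Integrable z μ := integrable_inputFun H.cont₁ _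
  obtain ⟨C, hC0, hC⟩ := H.exists_norm_monodromyKernel_le
  obtain ⟨C', hC'0, hC'⟩ := H.exists_norm_le T
  obtain ⟨M, hM⟩ := (isCompact_Icc (a := (0 : ℝ)) (b := T)).exists_bound_of_continuousOn
    (continuous_act.comp hW).continuousOn
  have mB : StronglyMeasurable fun p : ℝ × ℝ => act (U (h + p.1) (h + p.2)) :=
    (continuous_act.comp (hU.comp (f := fun p : ℝ × ℝ => (h + p.1, h + p.2))
      (by fun_prop))).stronglyMeasurable
  have hac := ae_atomMeasure_mem_Icc hh
  -- The auxiliary variable is a pair; the left kernel uses its first entry and the right kernel its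
  -- second.
  obtain ⟨s1, s2, s3⟩ := integral_inner_sandwich (μ := μ) (ρ := μ.prod μ) (f := f)
    (N₁ := fun q => act (N q.2.1 q.1)) (N₂ := fun q => act (N q.2.2 q.1))
    (B := fun p => act (U (h + p.1) (h + p.2))) (C₁ := C) (C₂ := C) (D := D)
    (H.stronglyMeasurable_monodromyKernel (by fun_prop) (by fun_prop)).aestronglyMeasurable
    (by
      filter_upwards [Measure.quasiMeasurePreserving_fst.ae hac,
        Measure.quasiMeasurePreserving_snd.ae (ae_prod_atomMeasure_mem hh)] with q h1 h2
      exact hC _ h2.1 _ h1)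
    (H.stronglyMeasurable_monodromyKernel (by fun_prop) (by fun_prop)).aestronglyMeasurable
    (by
      filter_upwards [Measure.quasiMeasurePreserving_fst.ae hac,
        Measure.quasiMeasurePreserving_snd.ae (ae_prod_atomMeasure_mem hh)] with q h1 h2
      exact hC _ h2.2 _ h1)
    mB.aestronglyMeasurable (.of_forall fun p => hD _ _) hfi
  have bK : ∀ᵐ q ∂(μ.prod (volume.restrict (Ioc 0 T))), ‖act (K q.2 (h + q.1))‖ ≤ C' := by
    filter_upwards [Measure.quasiMeasurePreserving_fst.ae hac,
      Measure.quasiMeasurePreserving_snd.ae (ae_restrict_mem measurableSet_Ioc)] with q h1 h2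
    exact hC' _ _ h2.2 (by linarith [h1.1])
  have mK : StronglyMeasurable fun q : ℝ × ℝ => act (K q.2 (h + q.1)) :=
    H.stronglyMeasurable_act_fundMatrix (by fun_prop) (by fun_prop)
  obtain ⟨t1, t2, t3⟩ := integral_inner_sandwich (μ := μ) (ρ := volume.restrict (Ioc 0 T)) (f := f)
    (N₁ := fun q => act (K q.2 (h + q.1))) (N₂ := fun q => act (K q.2 (h + q.1)))
    (B := fun ω => act (W ω)) (D := M) mK.aestronglyMeasurable bK mK.aestronglyMeasurable bK
    (continuous_act.comp hW).aestronglyMeasurable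
    ((ae_restrict_mem measurableSet_Ioc).mono fun ω hω => hM ω (Ioc_subset_Icc_self hω)) hfi
  have hrow : ∀ᵐ ξ ∂μ, rowFun A₁ U (h + ξ) φ
      = (∫ s, (∫ p, ContinuousLinearMap.adjoint (act (N p.1 ξ)) * act (U (h + p.1) (h + p.2))
          * act (N p.2 s) ∂(μ.prod μ)) (f s) ∂μ)
        + ∫ s, (∫ ω in Ioc 0 T, ContinuousLinearMap.adjoint (act (K ω (h + ξ))) * act (W ω)
          * act (K ω (h + s))) (f s) ∂μ := by
    filter_upwards [hac, s1, t1] with ξ hξ i1 i2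
    rw [← integral_add i1 i2]
    refine integral_congr_ae ?_
    filter_upwards [hac] with s hs
    have hl : ∀ {ξ : ℝ}, ξ ∈ Icc (-h) 0 → h + ξ ∈ Icc 0 h := fun hξ =>
      ⟨by linarith [hξ.1], by linarith [hξ.2]⟩
    rw [hUeq _ (hl hξ) _ (hl hs), act_add, H.act_opL hU hD hξ hs,
      H.act_inhom hW (hl hξ).1 (hl hs).1]
    rfl
  have e1 : ∫ ξ, inner ℂ (f ξ) (rowFun A₁ U (h + ξ) φ) ∂μ = _ :=
    integral_congr_ae (hrow.mono fun ξ hξ =>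
      (congrArg (inner ℂ (f ξ)) hξ).trans (inner_add_right _ _ _))
  rw [e1, integral_add s2 t2, s3, t3]
  congr 1
  -- The inner integrals are the density of the monodromy state, so the integral over pairs is its
  -- quadratic form.
  have hker : ∀ᵐ r ∂μ, ∫ s, act (N r s) (f s) ∂μ = z r := H.integral_monodromyKernel hhT φ
  have hzz : Integrable (fun p : ℝ × ℝ => inner ℂ (z p.1) (act (U (h + p.1) (h + p.2)) (z p.2)))
      (μ.prod μ) := by
    refine ((hzi.norm.mul_prod hzi.norm).const_mul D).mono'
      ((hzi.comp_fst μ).aestronglyMeasurable.inner (aestronglyMeasurable_clm_apply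
        mB.aestronglyMeasurable (hzi.comp_snd μ).aestronglyMeasurable)) (.of_forall fun p => ?_)
    refine (norm_inner_le_norm _ _).trans ?_
    calc _ ≤ ‖z p.1‖ * (D * ‖z p.2‖) := by
          gcongr
          exact (act _).le_of_opNorm_le (hD _ _) _
      _ = _ := by ring
  calc _ = ∫ p, inner ℂ (z p.1) (act (U (h + p.1) (h + p.2)) (z p.2)) ∂(μ.prod μ) := by
        refine integral_congr_ae ?_
        filter_upwards [Measure.quasiMeasurePreserving_fst.ae hker,
          Measure.quasiMeasurePreserving_snd.ae hker] with p h1 h2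
        rw [h1, h2]
    _ = ∫ r, (∫ s, inner ℂ (z r) (act (U (h + r) (h + s)) (z s)) ∂μ) ∂μ := integral_prod _ hzz
    _ = _ := by
        refine integral_congr_ae (.of_forall fun r => ?_)
        exact integral_inner (integrable_rowFun H.cont₁ hU hD (h + r) _) (z r)

end Lyapunov

end DelayLyap

end

open DelayLyap
theorem mainTheorem5 (n : ℕ) (h T : ℝ) (hh : 0 ≤ h) (hT : 0 < T) (hhT : h ≤ T)
    (A₀ A₁ W : ℝ → Mat n)
    (hA₀ : Continuous A₀) (hA₀T : Function.Periodic A₀ T)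
    (hA₁ : Continuous A₁) (hA₁T : Function.Periodic A₁ T)
    (hW : Continuous W) (hWT : Function.Periodic W T) (hWsymm : ∀ t, (W t).transpose = W t)
    (U₀ : ℝ → ℝ → Mat n)
    (hU₀ : ContinuousOn (fun p : ℝ × ℝ => U₀ p.1 p.2) (Set.Icc 0 h ×ˢ Set.Icc 0 h))
    (hU₀eq : ∀ θ ∈ Set.Icc 0 h, ∀ s ∈ Set.Icc 0 h,
      U₀ θ s = opL A₁ h T (fundMatrix A₀ A₁ h) U₀ θ s + inhom W T (fundMatrix A₀ A₁ h) θ s) :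
    ∃ P : State n h →L[ℂ] State n h, IsLyapunovOperator A₁ U₀ P ∧
      ∀ φ : State n h,
        IntervalIntegrable
          (fun ξ => inner ℂ (evolution A₀ A₁ h ξ 0 φ)
            (weightOp h W ξ (evolution A₀ A₁ h ξ 0 φ))) MeasureTheory.volume 0 T ∧
        inner ℂ φ (P φ) - inner ℂ (monodromy A₀ A₁ h T φ) (P (monodromy A₀ A₁ h T φ))
          = ∫ ξ in (0 : ℝ)..T, inner ℂ (evolution A₀ A₁ h ξ 0 φ)
              (weightOp h W ξ (evolution A₀ A₁ h ξ 0 φ)) := by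
  have H : IsAdmissible A₀ A₁ h T := ⟨hh, hT, hA₀, hA₀T, hA₁, hA₁T⟩
  have hle : -h ≤ 0 := by linarith
  have h0 : (0 : ℝ) ∈ Icc 0 h := ⟨le_rfl, hh⟩
  have hl : ∀ {ξ : ℝ}, ξ ∈ Icc (-h) 0 → h + ξ ∈ Icc 0 h := fun hξ =>
    ⟨by linarith [hξ.1], by linarith [hξ.2]⟩
  -- `U₀` is controlled only on the square. A bounded continuous extension permits estimates on the
  -- whole plane, and `𝓛` sees only the square, so the integral equation survives.
  obtain ⟨U, hU, hUU, D, hD⟩ := exists_continuous_extension hh hU₀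
  obtain ⟨P, hP⟩ := exists_lyapunovOperator hh hA₁ hU hD
  have hUeq : ∀ θ ∈ Icc 0 h, ∀ s ∈ Icc 0 h,
      U θ s = opL A₁ h T (fundMatrix A₀ A₁ h) U θ s + inhom W T (fundMatrix A₀ A₁ h) θ s :=
    fun θ hθ s hs => by
      rw [← hUU θ hθ s hs, ← opL_congr hh _ hUU]
      exact hU₀eq θ hθ s hs
  have hrow : ∀ r ∈ Icc 0 h, ∀ φ : State n h, rowFun A₁ U r φ = act (U₀ r 0) φ.fst
      + ∫ θ in (-h)..0, act (U₀ r (h + θ) * A₁ (h + θ)) (φ.snd θ) := fun r hr φ => by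
    rw [rowFun_eq hh hA₁ hU hD, hUU r hr 0 h0]
    congr 1
    refine intervalIntegral.integral_congr fun θ hθ => ?_
    rw [uIcc_of_le hle] at hθ
    simp only [hUU r hr _ (hl hθ)]
  refine ⟨P, ⟨fun φ => by rw [(hP φ).1, hrow 0 h0], fun φ => ?_⟩, fun φ => ⟨?_, ?_⟩⟩
  · filter_upwards [(hP φ).2, ae_restrict_mem measurableSet_Icc] with θ h1 hθ
    rw [h1, colFun, hrow _ (hl hθ)]
  · exact H.intervalIntegrable_inner_weightOp hW φ
  · rw [inner_lyapunovOperator hh hA₁ hU hD (hP φ).1 (hP φ).2,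
      inner_lyapunovOperator hh hA₁ hU hD (hP _).1 (hP _).2,
      H.integral_rowFun_eq hhT hW hU hD hUeq φ, add_sub_cancel_left,
      intervalIntegral.integral_of_le hT.le]
    refine setIntegral_congr_fun measurableSet_Ioc fun ω hω => ?_
    simp only [inner_weightOp, H.evolution_fst φ hω.1.le]
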